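/- Let $q$ be a prime power and let $E_r(q,n)$ be the set of $r$-dimensional subspaces of $\mathrm{GF}(q)^n$, with subspace distance $d_S(U,V)=\dim(U+V)-\dim(U\cap V)$. Let $N_S(r,s,e)$ be the number of $s$-dimensional subspaces at subspace distance $e$ from a given $r$-dimensional subspace, and let $J_S(u,s,w;a,b,c)$ be the number of $c$-dimensional subspaces at subspace distance $u$ from $A$ and $s$ from $B$, where $\dim A=a$, $\dim B=b$, $d_S(A,B)=w$ (these numbers do not depend on the choice of the given subspaces; $J_S=0$ if no such $A,B$ exist). Put $\alpha(m,u)=\prod_{i=0}^{u-1}(q^m-q^i)$, ${n \brack u}=\alpha(n,u)/\alpha(u,u)$, $K_q=\prod_{j\ge1}(1-q^{-j})$ and $L_q=K_q^{-2}\sum_{i=0}^\infty q^{-\frac34 i^2}$. An operator channel sends a subspace $X$ of $\mathrm{GF}(q)^n$ to a random subspace $Y$ of $\mathrm{GF}(q)^n$; it is symmetric if, for each $X$, all outputs $Y$ with the same number of errors $\dim Y-\dim(X\cap Y)$ and the same number of erasures $\dim X-\dim(X\cap Y)$ are equiprobable. A bounded subspace distance decoder of radius $t$ for a code $\mathcal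 C$ returns a codeword at subspace distance at most $t$ from the received subspace if there is one, and declares a failure otherwise. Let $d\ge 1$, let $\mathcal C\subseteq E_r(q,n)$ be a code in which distinct codewords are at subspace distance at least $2d$, and let $C\in\mathcal C$. Put $A_w(C)=|\{D\in\mathcal C: d_S(D,C)=2w\}|$. For a symmetric operator channel and a bounded subspace distance decoder of radius $d-1$, let $P_S(C,u,v,d-1)$ be the decoder error probability (DEP): the probability that the decoder returns a codeword other than $C$, given that $C$ is sent and that the received subspace has dimension $v$ and is at subspace distance $u$ from $C$ (taken as $0$ if this condition has probability $0$). 1. If $N_S(r,v,u)>0$, $u\ge d+1$ and $|v-r|\le d-1$, then $$P_S(C,u,v,d-1)=\frac1{N_S(r,v,u)}\sum_{w=d}^r A_w(C)\sum_{s=0}^{d-1}J_S(u,s,2w;r,r,v)$$ provided that, when $C$ is sent, the received subspace has dimension $v$ and is at distance $u$ from $C$ with positive probability. If $N_S(r,v,u)=0$ or $u\le d$ or $|v-r|>d-1$, then $P_S(C,u,v,d-1)=0$. 2. Suppose moreover that $2r\le n$, that $N_S(r,v,u)>0$, and that $\mathcal C$ is the lifting of a rank metric code, i.e. $\mathcal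 C=\{I(\mathbf M):\mathbf M\in\mathcal R\}$ for a set $\mathcal R$ of $r\times(n-r)$ matrices over $\mathrm{GF}(q)$, where $I(\mathbf M)$ is the row space of $(\mathbf I_r\,|\,\mathbf M)$. Then $$P_S(C,u,v,d-1)\le\frac1{N_S(r,v,u)}\sum_{w=d}^r{r\brack w}\alpha(n-r,w-d+1)\sum_{s=0}^{d-1}J_S(u,s,2w;r,r,v),$$ and the right-hand side is strictly less than $$L_q\,q^{-\frac{d-1+v-r}2\left(n-2r+\frac{d-1-v+r}2\right)}\quad\text{if } d-1+r-v \text{ is even},$$ $$L_q\,q^{-\frac{d-1+v-r}2\left(n-2r+\frac{d-1+r-v}2\right)-\frac12\left(n-d+1+\frac12\right)}\quad\text{if } d-1+r-v \text{ is odd}.$$ -/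

import Mathlib

open Module

noncomputable section

namespace SubspaceCoding

/-! Throughout, `F` is a finite field, `q = Fintype.card F`, and the projective space `E(q,n)` is
the set of all subspaces of `F ^ n`. -/

/-- The set `E(q,n)` of all subspaces of `F ^ n`. -/
abbrev Subspaces (F : Type*) [Field F] (n : ℕ) : Type _ := Submodule F (Fin n → F)

/-- The subspace distance `dim (U + V) - dim (U ∩ V)`. -/
def subspaceDist {F : Type*} [Field F] {n : ℕ} (U V : Subspaces F n) : ℕ :=
  finrank F ↥(U ⊔ V) - finrank F ↥(U ⊓ V)

/-! ### Numbers of subspaces -/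

/-- The subspaces of dimension `v` at subspace distance `u` from `U`. -/
def sphere {F : Type*} [Field F] {n : ℕ} (U : Subspaces F n) (v u : ℕ) : Set (Subspaces F n) :=
  {Y | finrank F Y = v ∧ subspaceDist U Y = u}

open Classical in
/-- `N_S(r,s,d)`: the number of subspaces of dimension `s` at subspace distance `d` from a subspace
of dimension `r` (this number does not depend on the subspace of dimension `r`; it is `0` if there
is no such subspace). -/
def NS (F : Type*) [Field F] (n r s d : ℕ) : ℕ :=
  if h : ∃ A : Subspaces F n, finrank F A = r then (sphere h.choose s d).ncard else 0

open Classical in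
/-- `J_S(u,s,w;a,b,c)`: the number of subspaces of dimension `c` at subspace distance `u` from `A`
and at subspace distance `s` from `B`, where `A` and `B` have dimensions `a` and `b` and are at
subspace distance `w` from each other (this number does not depend on the choice of such a pair
`(A, B)`; it is `0` if there is no such pair). -/
def JS (F : Type*) [Field F] (n u s w a b c : ℕ) : ℕ :=
  if h : ∃ P : Subspaces F n × Subspaces F n,
      finrank F P.1 = a ∧ finrank F P.2 = b ∧ subspaceDist P.1 P.2 = w
  then (sphere h.choose.1 c u ∩ sphere h.choose.2 c s).ncard else 0

/-- `α(m,u) = ∏_{i=0}^{u-1} (q^m - q^i)`. -/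
def alpha (q m u : ℕ) : ℝ := ∏ i ∈ Finset.range u, ((q : ℝ) ^ m - (q : ℝ) ^ i)

/-- The Gaussian binomial `α(n,u) / α(u,u)`. -/
def gaussBinom (q n u : ℕ) : ℝ := alpha q n u / alpha q u u

/-- `K_q = ∏_{j ≥ 1} (1 - q^{-j})`. -/
def K (q : ℕ) : ℝ := ∏' j : ℕ, (1 - ((q : ℝ) ^ (j + 1))⁻¹)

/-- `L_q = K_q^{-2} ∑_{i ≥ 0} q^{-3 i² / 4}`. -/
def L (q : ℕ) : ℝ := (K q ^ 2)⁻¹ * ∑' i : ℕ, (q : ℝ) ^ (-(3 / 4 * (i : ℝ) ^ 2))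

/-! ### Codes, liftings -/

/-- A constant-dimension code in `E_r(q,n)` in which distinct codewords are at subspace distance at
least `δ`. -/
structure IsCDC {F : Type*} [Field F] {n : ℕ} (𝒞 : Set (Subspaces F n)) (r δ : ℕ) : Prop where
  finrank_eq : ∀ X ∈ 𝒞, finrank F X = r
  le_dist : ∀ X ∈ 𝒞, ∀ Y ∈ 𝒞, X ≠ Y → δ ≤ subspaceDist X Y

/-- The distance distribution with respect to `C`: the number `A_w(C)` of codewords at injection
distance `w`, that is at subspace distance `2 w`, from `C`. -/
def distDistr {F : Type*} [Field F] {n : ℕ} (𝒞 : Set (Subspaces F n)) (C : Subspaces F n)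
    (w : ℕ) : ℕ :=
  {D | D ∈ 𝒞 ∧ subspaceDist D C = 2 * w}.ncard

/-- The `r × n` matrix `(I_r | M)`. -/
def liftMatrix {F : Type*} [Field F] {n r : ℕ} (M : Matrix (Fin r) (Fin (n - r)) F) :
    Matrix (Fin r) (Fin n) F :=
  Matrix.of fun i j =>
    if h : (j : ℕ) < r then (if (j : ℕ) = (i : ℕ) then 1 else 0)
    else M i ⟨(j : ℕ) - r, by have := j.isLt; omega⟩

/-- The lifting of `M`: the row space of `(I_r | M)`. -/
def lift {F : Type*} [Field F] {n r : ℕ} (M : Matrix (Fin r) (Fin (n - r)) F) : Subspaces F n :=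
  Submodule.span F (Set.range (liftMatrix M).row)

/-! ### Operator channels, decoders, decoder error probability -/

/-- An operator channel on `E(q,n)`: for each input, a probability distribution on the outputs. -/
abbrev OperatorChannel (F : Type*) [Field F] (n : ℕ) : Type _ := Subspaces F n → PMF (Subspaces F n)

/-- The number of errors (erroneous dimensions) when `X` is sent and `Y` is received. -/
def numErrors {F : Type*} [Field F] {n : ℕ} (X Y : Subspaces F n) : ℕ :=
  finrank F Y - finrank F ↥(X ⊓ Y)

/-- The number of erasures (lost dimensions) when `X` is sent and `Y` is received. -/
def numErasures {F : Type*} [Field F] {n : ℕ} (X Y : Subspaces F n) : ℕ :=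
  finrank F X - finrank F ↥(X ⊓ Y)

/-- An operator channel is symmetric when, for each input, all the outputs that correspond to the
same number of errors and the same number of erasures are equiprobable. -/
def OperatorChannel.IsSymmetric {F : Type*} [Field F] {n : ℕ} (W : OperatorChannel F n) : Prop :=
  ∀ X Y Y' : Subspaces F n, numErrors X Y = numErrors X Y' → numErasures X Y = numErasures X Y' →
    W X Y = W X Y'

/-- `dec` is a bounded subspace distance decoder with decoding radius `t` for the code `𝒞`: it
returns a codeword at subspace distance at most `t` from the received subspace if there is one, and
declares a failure (`none`) otherwise. -/
structure IsBDD {F : Type*} [Field F] {n : ℕ} (𝒞 : Set (Subspaces F n)) (t : ℕ)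
    (dec : Subspaces F n → Option (Subspaces F n)) : Prop where
  of_some : ∀ Y X, dec Y = some X → X ∈ 𝒞 ∧ subspaceDist X Y ≤ t
  of_none : ∀ Y, dec Y = none → ∀ X ∈ 𝒞, t < subspaceDist X Y

/-- The decoder error probability: the probability that the decoder returns a codeword other than
`C`, given that `C` is sent and that the received subspace has dimension `v` and is at subspace
distance `u` from `C` (`0` if the conditioning event has probability `0`). -/
def DEP {F : Type*} [Field F] {n : ℕ} (W : OperatorChannel F n)
    (dec : Subspaces F n → Option (Subspaces F n)) (C : Subspaces F n) (u v : ℕ) : ℝ :=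
  ((W C).toOuterMeasure (sphere C v u ∩ {Y | ∃ X, dec Y = some X ∧ X ≠ C}) /
    (W C).toOuterMeasure (sphere C v u)).toReal

end SubspaceCoding

end

namespace SubspaceCoding

/-! ### The subspace distance -/

section Dist

variable {F : Type*} [Field F] {n : ℕ}

/-! Dimension and distance from `C` determine the dimension of the intersection with `C`, hence the
numbers of errors and erasures. A symmetric channel is therefore uniform on `sphere C v u`, and the
DEP is the fraction of that sphere that is decoded wrongly (`DEP_eq_ncard_div`). Balls of radius `d
- 1` about codewords are disjoint, so the wrongly decoded subspaces are partitioned by the codeword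
`D ≠ C` they fall to and by their distance `s < d` from it. Since `GL_n` is transitive on pairs of
subspaces of given dimensions and distance, each piece has size `JS`; grouping the `D` by distance
`2w` gives the exact formula (`ncard_decoderError`).

For a lifted code, `A_w(C)` counts matrices of rank `w` at mutual rank distance at least `d`. A
Singleton-type argument, one kernel at a time, gives `A_w ≤ [r w] α(n-r, w-d+1)`
(`ncard_rankMetric_le`). This bound is at most `q^{-(n-r)(d-1)} NS(r,r,2w)`
(`gaussBinom_mul_alpha_le`), which amounts to replacing the code by a fixed proportion of all
`r`-dimensional subspaces. Double counting pairs `(Y, D)` then removes `JS`: `∑_w NS(r,r,2w) JS ≤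
NS(r,v,u) NS(v,r,s)`. There remains `q^{-(n-r)(d-1)} ∑_{s<d} NS(v,r,s)`.

Estimating the two Gaussian binomials in `NS(v,r,s)` costs `K_q^{-2}` and leaves a power of `q`.
Only `s ≡ v + r` mod 2 contribute; with `s = d-1-k` and `i = ⌊k/2⌋`, the exponent lies at least
`3i²/4` below its value `T` at `i = 0`. The sum is thus a finite part of the series defining `L_q`,
times `q^T`, which also explains the strict inequality. -/

lemma subspaceDist_add (U V : Subspaces F n) :
    subspaceDist U V + 2 * finrank F ↥(U ⊓ V) = finrank F U + finrank F V := by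
  have h := Submodule.finrank_sup_add_finrank_inf_eq U V
  have h1 : finrank F ↥(U ⊓ V) ≤ finrank F U := Submodule.finrank_mono inf_le_left
  have h2 : finrank F ↥(U ⊓ V) ≤ finrank F V := Submodule.finrank_mono inf_le_right
  unfold subspaceDist
  omega

lemma subspaceDist_comm (U V : Subspaces F n) : subspaceDist U V = subspaceDist V U := by
  unfold subspaceDist
  rw [sup_comm, inf_comm]

lemma subspaceDist_self (U : Subspaces F n) : subspaceDist U U = 0 := by
  rw [subspaceDist, sup_idem, inf_idem, Nat.sub_self]

lemma subspaceDist_triangle (U V W : Subspaces F n) :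
    subspaceDist U W ≤ subspaceDist U V + subspaceDist V W := by
  have h := Submodule.finrank_sup_add_finrank_inf_eq (U ⊓ V) (V ⊓ W)
  have h1 : finrank F ↥((U ⊓ V) ⊔ (V ⊓ W)) ≤ finrank F V :=
    Submodule.finrank_mono (sup_le inf_le_right inf_le_left)
  have h2 : finrank F ↥((U ⊓ V) ⊓ (V ⊓ W)) ≤ finrank F ↥(U ⊓ W) :=
    Submodule.finrank_mono
      (le_inf (inf_le_left.trans inf_le_left) (inf_le_right.trans inf_le_right))
  have a := subspaceDist_add U V
  have b := subspaceDist_add V W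
  have c := subspaceDist_add U W
  omega

lemma finrank_inf_le (U V : Subspaces F n) :
    finrank F ↥(U ⊓ V) ≤ finrank F U ∧ finrank F ↥(U ⊓ V) ≤ finrank F V :=
  ⟨Submodule.finrank_mono inf_le_left, Submodule.finrank_mono inf_le_right⟩

lemma mem_sphere {U Y : Subspaces F n} {v u : ℕ} :
    Y ∈ sphere U v u ↔ finrank F Y = v ∧ subspaceDist U Y = u := Iff.rfl

end Dist

/-! ### Transitivity of the general linear group -/

section Transitive

variable {F V : Type*} [Field F] [AddCommGroup V] [Module F V]

lemma exists_isCompl_within {P A : Submodule F V} (h : P ≤ A) :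
    ∃ X : Submodule F V, P ⊔ X = A ∧ Disjoint P X := by
  obtain ⟨Z, hZ⟩ := Submodule.exists_isCompl P
  refine ⟨Z ⊓ A, ?_, hZ.disjoint.mono_right inf_le_left⟩
  rw [← sup_inf_assoc_of_le _ h, hZ.sup_eq_top, top_inf_eq]

variable [FiniteDimensional F V]

lemma finrank_of_disjoint_sup {P X A : Submodule F V} (h : P ⊔ X = A) (hd : Disjoint P X) :
    finrank F P + finrank F X = finrank F A := by
  rw [← h, ← Submodule.finrank_sup_add_finrank_inf_eq P X, hd.eq_bot, finrank_bot, add_zero]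

lemma exists_sum_equiv (P X Y Z : Submodule F V) (htop : P ⊔ (X ⊔ (Y ⊔ Z)) = ⊤)
    (hdim : finrank F P + (finrank F X + (finrank F Y + finrank F Z)) = finrank F V) :
    ∃ φ : (P × X × Y × Z) ≃ₗ[F] V,
      ∀ p, φ p = (p.1 : V) + p.2.1 + p.2.2.1 + p.2.2.2 := by
  let f : (P × X × Y × Z) →ₗ[F] V :=
    P.subtype.coprod (X.subtype.coprod (Y.subtype.coprod Z.subtype))
  have hf : ∀ p, f p = (p.1 : V) + p.2.1 + p.2.2.1 + p.2.2.2 := by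
    rintro ⟨a, b, c, d⟩
    simp [f, add_assoc]
  have hsurj : Function.Surjective f := by
    rw [← LinearMap.range_eq_top]
    simpa only [f, LinearMap.range_coprod, Submodule.range_subtype] using htop
  have hdim' : finrank F (P × X × Y × Z) = finrank F V := by
    rw [finrank_prod, finrank_prod, finrank_prod, hdim]
  exact ⟨LinearEquiv.ofBijective f
    ⟨(LinearMap.injective_iff_surjective_of_finrank_eq_finrank hdim').2 hsurj, hsurj⟩, hf⟩

/-- Coordinates adapted to a pair of subspaces. -/
lemma exists_adapted_equiv (A B : Submodule F V) :
    ∃ (X Y Z : Submodule F V) (φ : (↥(A ⊓ B) × X × Y × Z) ≃ₗ[F] V),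
      (∀ p, φ p = (p.1 : V) + p.2.1 + p.2.2.1 + p.2.2.2) ∧
      (A ⊓ B) ⊔ X = A ∧ (A ⊓ B) ⊔ Y = B ∧
      finrank F ↥(A ⊓ B) + finrank F X = finrank F A ∧
      finrank F ↥(A ⊓ B) + finrank F Y = finrank F B ∧
      finrank F ↥(A ⊔ B) + finrank F Z = finrank F V := by
  obtain ⟨X, hX, hX'⟩ := exists_isCompl_within (inf_le_left : A ⊓ B ≤ A)
  obtain ⟨Y, hY, hY'⟩ := exists_isCompl_within (inf_le_right : A ⊓ B ≤ B)
  obtain ⟨Z, hZ⟩ := Submodule.exists_isCompl (A ⊔ B)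
  have hx := finrank_of_disjoint_sup hX hX'
  have hy := finrank_of_disjoint_sup hY hY'
  have hz := Submodule.finrank_add_eq_of_isCompl hZ
  have h := Submodule.finrank_sup_add_finrank_inf_eq A B
  obtain ⟨φ, hφ⟩ := exists_sum_equiv (A ⊓ B) X Y Z (by
    rw [eq_top_iff, ← hZ.sup_eq_top]
    refine sup_le (sup_le ?_ ?_) ?_
    · conv_lhs => rw [← hX]
      exact sup_le le_sup_left (le_sup_of_le_right le_sup_left)
    · conv_lhs => rw [← hY]
      exact sup_le le_sup_left (le_sup_of_le_right (le_sup_of_le_right le_sup_left))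
    · exact le_sup_of_le_right (le_sup_of_le_right le_sup_right)) (by omega)
  exact ⟨X, Y, Z, φ, hφ, hX, hY, hx, hy, hz⟩

/-- Both pairs have adapted decompositions `(A ⊓ B) ⊕ X ⊕ Y ⊕ Z` whose blocks have equal dimensions,
so they can be matched block by block. This transitivity is what makes `NS` and `JS` independent of
choices. -/
lemma exists_linearEquiv_map_pair {A B A' B' : Submodule F V}
    (hA : finrank F A = finrank F A') (hB : finrank F B = finrank F B')
    (hAB : finrank F ↥(A ⊓ B) = finrank F ↥(A' ⊓ B')) :
    ∃ e : V ≃ₗ[F] V, A.map e.toLinearMap = A' ∧ B.map e.toLinearMap = B' := by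
  obtain ⟨X, Y, Z, φ, hφ, hX, hY, hx, hy, hz⟩ := exists_adapted_equiv A B
  obtain ⟨X', Y', Z', φ', hφ', hX', hY', hx', hy', hz'⟩ := exists_adapted_equiv A' B'
  have h1 := Submodule.finrank_sup_add_finrank_inf_eq A B
  have h2 := Submodule.finrank_sup_add_finrank_inf_eq A' B'
  let e1 := LinearEquiv.ofFinrankEq _ _ hAB
  let e2 := LinearEquiv.ofFinrankEq (R := F) X X' (by omega)
  let e3 := LinearEquiv.ofFinrankEq (R := F) Y Y' (by omega)
  let e4 := LinearEquiv.ofFinrankEq (R := F) Z Z' (by omega)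
  let e : V ≃ₗ[F] V := φ.symm ≪≫ₗ (e1.prodCongr (e2.prodCongr (e3.prodCongr e4))) ≪≫ₗ φ'
  have he : ∀ p, e (φ p) = (e1 p.1 : V) + e2 p.2.1 + e3 p.2.2.1 + e4 p.2.2.2 := by
    intro p
    simp [e, hφ']
  refine ⟨e, ?_, ?_⟩
  · refine Submodule.eq_of_le_of_finrank_eq ?_ (by rw [LinearEquiv.finrank_map_eq]; exact hA)
    rw [Submodule.map_le_iff_le_comap, ← hX]
    refine sup_le (fun a ha => ?_) (fun a ha => ?_)
    · have := he (⟨a, ha⟩, 0, 0, 0)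
      simp only [hφ, ZeroMemClass.coe_zero, add_zero, map_zero] at this
      simp only [Submodule.mem_comap, LinearEquiv.coe_coe, this]
      exact (inf_le_left : A' ⊓ B' ≤ A') (Subtype.mem _)
    · have := he (0, ⟨a, ha⟩, 0, 0)
      simp only [hφ, ZeroMemClass.coe_zero, add_zero, zero_add, map_zero] at this
      simp only [Submodule.mem_comap, LinearEquiv.coe_coe, this]
      rw [← hX']
      exact (le_sup_right : X' ≤ _) (Subtype.mem _)
  · refine Submodule.eq_of_le_of_finrank_eq ?_ (by rw [LinearEquiv.finrank_map_eq]; exact hB)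
    rw [Submodule.map_le_iff_le_comap, ← hY]
    refine sup_le (fun a ha => ?_) (fun a ha => ?_)
    · have := he (⟨a, ha⟩, 0, 0, 0)
      simp only [hφ, ZeroMemClass.coe_zero, add_zero, map_zero] at this
      simp only [Submodule.mem_comap, LinearEquiv.coe_coe, this]
      exact (inf_le_right : A' ⊓ B' ≤ B') (Subtype.mem _)
    · have := he (0, 0, ⟨a, ha⟩, 0)
      simp only [hφ, ZeroMemClass.coe_zero, add_zero, zero_add, map_zero] at this
      simp only [Submodule.mem_comap, LinearEquiv.coe_coe, this]
      rw [← hY']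
      exact (le_sup_right : Y' ≤ _) (Subtype.mem _)

end Transitive

/-! ### `NS` and `JS` as cardinalities -/

section Numbers

variable {F : Type*} [Field F] {n : ℕ}

lemma subspaceDist_map (e : (Fin n → F) ≃ₗ[F] (Fin n → F)) (U V : Subspaces F n) :
    subspaceDist (U.map e.toLinearMap) (V.map e.toLinearMap)
      = subspaceDist U V := by
  have h : U.map e.toLinearMap ⊓ V.map e.toLinearMap
      = (U ⊓ V).map e.toLinearMap :=
    (Submodule.map_inf _ e.injective).symm
  rw [subspaceDist, subspaceDist, ← Submodule.map_sup, h, LinearEquiv.finrank_map_eq,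
    LinearEquiv.finrank_map_eq]

lemma sphere_map (e : (Fin n → F) ≃ₗ[F] (Fin n → F)) (U : Subspaces F n) (v u : ℕ) :
    sphere (U.map e.toLinearMap) v u =
      (Submodule.map e.toLinearMap) '' sphere U v u := by
  ext Y
  constructor
  · rintro ⟨h1, h2⟩
    have hY : (Y.map e.symm.toLinearMap).map e.toLinearMap = Y := by
      rw [← Submodule.map_comp]
      simp
    refine ⟨Y.map e.symm.toLinearMap, ⟨?_, ?_⟩, hY⟩
    · rw [LinearEquiv.finrank_map_eq, h1]
    · rw [← subspaceDist_map e, hY, h2]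
  · rintro ⟨Z, ⟨h1, h2⟩, rfl⟩
    exact ⟨by rw [LinearEquiv.finrank_map_eq, h1], by rw [subspaceDist_map, h2]⟩

lemma submodule_map_injective (e : (Fin n → F) ≃ₗ[F] (Fin n → F)) :
    Function.Injective (Submodule.map e.toLinearMap) :=
  Submodule.map_injective_of_injective e.injective

lemma ncard_sphere_inter_sphere_congr {A B A' B' : Subspaces F n}
    (hA : finrank F A = finrank F A') (hB : finrank F B = finrank F B')
    (hd : subspaceDist A B = subspaceDist A' B') (u s c : ℕ) :
    (sphere A c u ∩ sphere B c s).ncard = (sphere A' c u ∩ sphere B' c s).ncard := by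
  have h4 := subspaceDist_add A B
  have h5 := subspaceDist_add A' B'
  obtain ⟨e, rfl, rfl⟩ := exists_linearEquiv_map_pair hA hB (by omega)
  rw [sphere_map, sphere_map, ← Set.image_inter (submodule_map_injective e),
    Set.ncard_image_of_injective _ (submodule_map_injective e)]

lemma JS_eq_ncard {A B : Subspaces F n} (u s c : ℕ) :
    JS F n u s (subspaceDist A B) (finrank F A) (finrank F B) c =
      (sphere A c u ∩ sphere B c s).ncard := by
  have h : ∃ P : Subspaces F n × Subspaces F n, finrank F P.1 = finrank F A ∧
      finrank F P.2 = finrank F B ∧ subspaceDist P.1 P.2 = subspaceDist A B :=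
    ⟨(A, B), rfl, rfl, rfl⟩
  rw [JS, dif_pos h]
  obtain ⟨h1, h2, h3⟩ := h.choose_spec
  exact ncard_sphere_inter_sphere_congr h1 h2 h3 u s c

lemma NS_eq_ncard (A : Subspaces F n) (s d : ℕ) :
    NS F n (finrank F A) s d = (sphere A s d).ncard := by
  have h : ∃ B : Subspaces F n, finrank F B = finrank F A := ⟨A, rfl⟩
  rw [NS, dif_pos h]
  have h1 := h.choose_spec
  -- The case of a pair `(A, A)`, at distance `0`.
  simpa only [Set.inter_self] using ncard_sphere_inter_sphere_congr h1 h1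
    ((subspaceDist_self _).trans (subspaceDist_self _).symm) d d s

end Numbers

/-! ### The decoder error probability as a ratio of cardinalities -/

section DecoderError

variable {F : Type*} [Field F] {n : ℕ}

instance finite_subspaces [Finite F] : Finite (Subspaces F n) :=
  Finite.of_injective _ SetLike.coe_injective

lemma toOuterMeasure_eq_ncard_mul {α : Type*} [Finite α] (p : PMF α) {S : Set α} {c : ENNReal}
    (h : ∀ x ∈ S, p x = c) : p.toOuterMeasure S = S.ncard * c := by
  have hS := S.toFinite
  rw [Set.ncard_eq_toFinset_card S hS]
  conv_lhs => rw [← hS.coe_toFinset]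
  rw [PMF.toOuterMeasure_apply_finset,
    Finset.sum_congr rfl (fun x hx => h x (hS.mem_toFinset.1 hx)), Finset.sum_const, nsmul_eq_mul]

lemma OperatorChannel.IsSymmetric.eq_of_mem_sphere {W : OperatorChannel F n} (hW : W.IsSymmetric)
    {C Y Y' : Subspaces F n} {v u : ℕ} (hY : Y ∈ sphere C v u) (hY' : Y' ∈ sphere C v u) :
    W C Y = W C Y' := by
  have h1 := subspaceDist_add C Y
  have h2 := subspaceDist_add C Y'
  rw [hY.1, hY.2] at h1
  rw [hY'.1, hY'.2] at h2
  refine hW C Y Y' ?_ ?_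
  · rw [numErrors, numErrors, hY.1, hY'.1]
    omega
  · rw [numErasures, numErasures]
    omega

lemma DEP_eq_ncard_div [Finite F] {W : OperatorChannel F n} (hW : W.IsSymmetric)
    (dec : Subspaces F n → Option (Subspaces F n)) (C : Subspaces F n) (u v : ℕ)
    (hpos : 0 < (W C).toOuterMeasure (sphere C v u)) :
    DEP W dec C u v =
      ((sphere C v u ∩ {Y | ∃ X, dec Y = some X ∧ X ≠ C}).ncard : ℝ) / (sphere C v u).ncard := by
  have hne : (sphere C v u).Nonempty := by
    rw [Set.nonempty_iff_ne_empty]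
    intro h
    simp [h] at hpos
  obtain ⟨Y₀, hY₀⟩ := hne
  have hc : ∀ Y ∈ sphere C v u, W C Y = W C Y₀ := fun Y hY => hW.eq_of_mem_sphere hY hY₀
  -- The common probability of the points of the sphere is nonzero and finite, so it cancels from
  -- the quotient.
  have hc0 : W C Y₀ ≠ 0 := by
    intro h
    rw [toOuterMeasure_eq_ncard_mul _ hc, h, mul_zero] at hpos
    exact hpos.false
  rw [DEP, toOuterMeasure_eq_ncard_mul _ hc,
    toOuterMeasure_eq_ncard_mul (W C) (fun Y hY => hc Y hY.1),
    ENNReal.mul_div_mul_right _ _ hc0 ((W C).apply_ne_top _), ENNReal.toReal_div]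
  simp

lemma DEP_eq_zero_of_measure_eq_zero {W : OperatorChannel F n}
    (dec : Subspaces F n → Option (Subspaces F n)) (C : Subspaces F n) (u v : ℕ)
    (h : (W C).toOuterMeasure (sphere C v u) = 0) : DEP W dec C u v = 0 := by
  have h' : (W C).toOuterMeasure (sphere C v u ∩ {Y | ∃ X, dec Y = some X ∧ X ≠ C}) = 0 :=
    MeasureTheory.measure_mono_null Set.inter_subset_left h
  rw [DEP, h', h]
  simp

lemma DEP_eq_zero_of_inter_eq_empty {W : OperatorChannel F n}
    (dec : Subspaces F n → Option (Subspaces F n)) (C : Subspaces F n) (u v : ℕ)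
    (h : sphere C v u ∩ {Y | ∃ X, dec Y = some X ∧ X ≠ C} = ∅) : DEP W dec C u v = 0 := by
  rw [DEP, h]
  simp

variable {r d : ℕ} {𝒞 : Set (Subspaces F n)}
  {dec : Subspaces F n → Option (Subspaces F n)}

/-- The received subspaces that are decoded erroneously. -/
lemma decoderError_iff (hd : 1 ≤ d) (h𝒞 : IsCDC 𝒞 r (2 * d)) (hdec : IsBDD 𝒞 (d - 1) dec)
    (C Y : Subspaces F n) :
    (∃ X, dec Y = some X ∧ X ≠ C) ↔ ∃ D ∈ 𝒞, D ≠ C ∧ subspaceDist D Y ≤ d - 1 := by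
  constructor
  · rintro ⟨X, hX, hne⟩
    exact ⟨X, (hdec.of_some Y X hX).1, hne, (hdec.of_some Y X hX).2⟩
  · rintro ⟨D, hD, hne, hdist⟩
    cases hY : dec Y with
    | none => exact absurd hdist (not_le.2 (hdec.of_none Y hY D hD))
    | some X =>
      obtain ⟨hX, hX'⟩ := hdec.of_some Y X hY
      refine ⟨X, rfl, ?_⟩
      by_cases hXD : X = D
      · rwa [hXD]
      · have h1 := h𝒞.le_dist X hX D hD hXD
        have h2 := subspaceDist_triangle X Y D
        rw [subspaceDist_comm Y D] at h2
        omega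

/-- The triangle inequality gives `u ≥ 2d - (d - 1)`, and a distance is never less than the
difference of the dimensions. -/
lemma decoderError_bounds (hd : 1 ≤ d) (h𝒞 : IsCDC 𝒞 r (2 * d)) {C : Subspaces F n} (hC : C ∈ 𝒞)
    {D Y : Subspaces F n} {u v : ℕ} (hD : D ∈ 𝒞) (hne : D ≠ C) (hY : Y ∈ sphere C v u)
    (hDY : subspaceDist D Y ≤ d - 1) : d + 1 ≤ u ∧ |(v : ℤ) - (r : ℤ)| ≤ (d : ℤ) - 1 := by
  have h1 := h𝒞.le_dist D hD C hC hne
  have h2 := subspaceDist_triangle D Y C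
  have h3 := subspaceDist_add D Y
  have h4 := finrank_inf_le D Y
  rw [subspaceDist_comm Y C, hY.2] at h2
  rw [h𝒞.finrank_eq D hD, hY.1] at h3 h4
  refine ⟨by omega, ?_⟩
  rw [abs_le]
  omega

open Classical in
lemma ncard_decoderError [Finite F] (hd : 1 ≤ d) (h𝒞 : IsCDC 𝒞 r (2 * d))
    (hdec : IsBDD 𝒞 (d - 1) dec) {C : Subspaces F n} (hC : C ∈ 𝒞) (u v : ℕ) :
    (sphere C v u ∩ {Y | ∃ X, dec Y = some X ∧ X ≠ C}).ncard =
      ∑ w ∈ Finset.Icc d r, distDistr 𝒞 C w * ∑ s ∈ Finset.range d, JS F n u s (2 * w) r r v := by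
  have := Fintype.ofFinite (Subspaces F n)
  let T : Finset (Subspaces F n) := Finset.univ.filter fun D => D ∈ 𝒞 ∧ D ≠ C
  let B : Subspaces F n → ℕ → Finset (Subspaces F n) := fun D s =>
    (sphere C v u ∩ sphere D v s).toFinset
  have hset : sphere C v u ∩ {Y | ∃ X, dec Y = some X ∧ X ≠ C} =
      ((T.biUnion fun D => (Finset.range d).biUnion (B D) : Finset (Subspaces F n)) :
        Set (Subspaces F n)) := by
    ext Y
    simp only [Set.mem_inter_iff, Set.mem_ofPred_eq, decoderError_iff hd h𝒞 hdec, Finset.coe_biUnion,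
      Set.mem_iUnion, Finset.mem_coe, T, B, Finset.mem_filter, Finset.mem_univ, true_and,
      Finset.mem_range, Set.coe_toFinset]
    constructor
    · rintro ⟨hY, D, hD, hne, hDY⟩
      exact ⟨D, ⟨hD, hne⟩, subspaceDist D Y, by omega, hY, hY.1, rfl⟩
    · rintro ⟨D, ⟨hD, hne⟩, s, hs, hY, -, rfl⟩
      exact ⟨hY, D, hD, hne, by omega⟩
  rw [hset, Set.ncard_coe_finset, Finset.card_biUnion]
  -- Subspaces of equal dimension `r` are at even distance, at most `2r`; halving loses nothing.
  · have hT : ∀ D ∈ T, subspaceDist D C / 2 ∈ Finset.Icc d r ∧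
        subspaceDist D C = 2 * (subspaceDist D C / 2) := by
      intro D hD
      simp only [T, Finset.mem_filter, Finset.mem_univ, true_and] at hD
      have h1 := h𝒞.le_dist D hD.1 C hC hD.2
      have h2 := subspaceDist_add D C
      rw [h𝒞.finrank_eq D hD.1, h𝒞.finrank_eq C hC] at h2
      rw [Finset.mem_Icc]
      omega
    rw [← Finset.sum_fiberwise_of_maps_to (t := Finset.Icc d r)
      (g := fun D => subspaceDist D C / 2) (fun D hD => (hT D hD).1)]
    refine Finset.sum_congr rfl fun w hw => ?_
    have hA : distDistr 𝒞 C w = (T.filter fun D => subspaceDist D C / 2 = w).card := by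
      rw [distDistr, ← Set.ncard_coe_finset]
      congr 1
      ext D
      rw [Finset.mem_Icc] at hw
      simp only [Set.mem_ofPred_eq, Finset.coe_filter]
      constructor
      · rintro ⟨h1, h2⟩
        refine ⟨?_, by omega⟩
        simp only [T, Finset.mem_filter, Finset.mem_univ, true_and]
        refine ⟨h1, ?_⟩
        rintro rfl
        -- `D = C` would force `w = 0`, while `w ≥ d ≥ 1`.
        rw [subspaceDist_self] at h2
        omega
      · rintro ⟨h1, h2⟩
        have h3 := (hT D h1).2
        simp only [T, Finset.mem_filter, Finset.mem_univ, true_and] at h1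
        exact ⟨h1.1, by omega⟩
    rw [hA, ← smul_eq_mul, ← Finset.sum_const]
    refine Finset.sum_congr rfl fun D hD => ?_
    rw [Finset.mem_filter] at hD
    have h2 := (hT D hD.1).2
    rw [hD.2] at h2
    have hD' := hD.1
    simp only [T, Finset.mem_filter, Finset.mem_univ, true_and] at hD'
    rw [Finset.card_biUnion]
    · refine Finset.sum_congr rfl fun s _ => ?_
      rw [← h2, subspaceDist_comm D C]
      have h3 := JS_eq_ncard (A := C) (B := D) u s v
      rw [h𝒞.finrank_eq D hD'.1, h𝒞.finrank_eq C hC] at h3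
      rw [h3, ← Set.ncard_eq_toFinset_card']
    · intro s _ s' _ hss
      simp only [Function.onFun, B, Finset.disjoint_left, Set.mem_toFinset]
      rintro Y ⟨-, -, h⟩ ⟨-, -, h'⟩
      exact hss (h.symm.trans h')
  · intro D hD D' hD' hne
    simp only [Function.onFun, Finset.disjoint_left, Finset.mem_biUnion, B, Set.mem_toFinset,
      Finset.mem_range, not_exists, not_and]
    rintro Y ⟨s, hs, -, -, h⟩ s' hs' ⟨-, -, h'⟩
    simp only [T, Finset.coe_filter, Finset.mem_univ, true_and, Set.mem_ofPred_eq] at hD hD'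
    have h1 := h𝒞.le_dist D hD.1 D' hD'.1 hne
    have h2 := subspaceDist_triangle D Y D'
    rw [subspaceDist_comm Y D'] at h2
    omega

lemma DEP_eq_sum [Finite F] (hd : 1 ≤ d) (h𝒞 : IsCDC 𝒞 r (2 * d))
    (hdec : IsBDD 𝒞 (d - 1) dec) {C : Subspaces F n} (hC : C ∈ 𝒞) (u v : ℕ)
    {W : OperatorChannel F n} (hW : W.IsSymmetric)
    (hpos : 0 < (W C).toOuterMeasure (sphere C v u)) :
    DEP W dec C u v = 1 / (NS F n r v u : ℝ) *
      ∑ w ∈ Finset.Icc d r, (distDistr 𝒞 C w : ℝ) *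
        ∑ s ∈ Finset.range d, (JS F n u s (2 * w) r r v : ℝ) := by
  have hNS := NS_eq_ncard C v u
  rw [h𝒞.finrank_eq C hC] at hNS
  rw [DEP_eq_ncard_div hW dec C u v hpos, ncard_decoderError hd h𝒞 hdec hC, hNS, one_div,
    div_eq_inv_mul]
  push_cast
  rfl

lemma DEP_eq_zero [Finite F] (hd : 1 ≤ d) (h𝒞 : IsCDC 𝒞 r (2 * d))
    (hdec : IsBDD 𝒞 (d - 1) dec) {C : Subspaces F n} (hC : C ∈ 𝒞) (u v : ℕ)
    (W : OperatorChannel F n)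
    (h : ¬ (0 < NS F n r v u ∧ d + 1 ≤ u ∧ |(v : ℤ) - (r : ℤ)| ≤ (d : ℤ) - 1)) :
    DEP W dec C u v = 0 := by
  refine DEP_eq_zero_of_inter_eq_empty dec C u v (Set.eq_empty_of_forall_notMem ?_)
  rintro Y ⟨hY, hY'⟩
  obtain ⟨D, hD, hne, hDY⟩ := (decoderError_iff hd h𝒞 hdec C Y).1 hY'
  refine h ⟨?_, decoderError_bounds hd h𝒞 hC hD hne hY hDY⟩
  have hNS := NS_eq_ncard C v u
  rw [h𝒞.finrank_eq C hC] at hNS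
  rw [hNS, Set.ncard_pos]
  exact ⟨Y, hY⟩

end DecoderError

/-! ### Counting tuples and subspaces over a finite field -/

section Alpha

lemma alpha_pos {q m u : ℕ} (hq : 1 < q) (h : u ≤ m) : 0 < alpha q m u := by
  refine Finset.prod_pos fun i hi => sub_pos.2 ?_
  have hi' := Finset.mem_range.1 hi
  exact pow_lt_pow_right₀ (by exact_mod_cast hq) (by omega)

lemma alpha_eq_zero {q m u : ℕ} (h : m < u) : alpha q m u = 0 :=
  Finset.prod_eq_zero (Finset.mem_range.2 h) (sub_self _)

lemma alpha_nonneg {q m u : ℕ} (hq : 1 < q) : 0 ≤ alpha q m u := by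
  rcases le_or_gt u m with h | h
  · exact (alpha_pos hq h).le
  · exact (alpha_eq_zero h).ge

lemma gaussBinom_nonneg {q m u : ℕ} (hq : 1 < q) : 0 ≤ gaussBinom q m u :=
  div_nonneg (alpha_nonneg hq) (alpha_nonneg hq)

lemma alpha_zero (q m : ℕ) : alpha q m 0 = 1 := by simp [alpha]

lemma alpha_add (q m u v : ℕ) :
    alpha q (u + m) (u + v) = alpha q (u + m) u * ((q : ℝ) ^ (u * v) * alpha q m v) := by
  rw [alpha, Finset.prod_range_add, alpha, alpha]
  congr 1
  have h : (q : ℝ) ^ (u * v) = ∏ _i ∈ Finset.range v, (q : ℝ) ^ u := by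
    rw [Finset.prod_const, Finset.card_range, pow_mul]
  rw [h, ← Finset.prod_mul_distrib]
  refine Finset.prod_congr rfl fun i _ => ?_
  ring

/-- Splitting the product `α(u+v, u+v)` after `u` or after `v` factors gives two expressions with
the same power `q^{uv}`. -/
lemma gaussBinom_symm {q : ℕ} (hq : 1 < q) (u v : ℕ) :
    gaussBinom q (u + v) u = gaussBinom q (u + v) v := by
  have h1 := alpha_add q v u v
  have h2 := alpha_add q u v u
  rw [add_comm v u, mul_comm v u] at h2
  rw [h1] at h2
  have hu := alpha_pos hq (le_refl u)
  have hv := alpha_pos hq (le_refl v)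
  have hp : (0 : ℝ) < (q : ℝ) ^ (u * v) := pow_pos (by positivity) _
  rw [gaussBinom, gaussBinom, div_eq_div_iff hu.ne' hv.ne']
  have h3 : (q : ℝ) ^ (u * v) * (alpha q (u + v) u * alpha q v v) =
      (q : ℝ) ^ (u * v) * (alpha q (u + v) v * alpha q u u) := by linarith
  exact mul_left_cancel₀ hp.ne' h3

end Alpha

section Tuples

variable {F : Type*} [Field F] [Fintype F] {V : Type*} [AddCommGroup V] [Module F V] [Finite V]

lemma card_linearIndependent_eq_alpha (k : ℕ) :
    (Nat.card {s : Fin k → V // LinearIndependent F s} : ℝ) =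
      alpha (Fintype.card F) (finrank F V) k := by
  rcases le_or_gt k (finrank F V) with h | h
  · rw [card_linearIndependent h, Nat.cast_prod, alpha, Finset.prod_range]
    refine Finset.prod_congr rfl fun i _ => ?_
    rw [Nat.cast_sub (Nat.pow_le_pow_right Fintype.card_pos (by omega))]
    push_cast
    rfl
  · rw [alpha_eq_zero h]
    have : IsEmpty {s : Fin k → V // LinearIndependent F s} := by
      refine ⟨fun s => ?_⟩
      have := s.2.fintype_card_le_finrank
      rw [Fintype.card_fin] at this
      omega
    simp

/-- A linear section of `f` over its range splits each tuple into an arbitrary tuple in the kernel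
and an independent tuple in the range. -/
lemma card_linearIndependent_comp {M N : Type*} [AddCommGroup M] [Module F M] [Finite M]
    [AddCommGroup N] [Module F N] (f : M →ₗ[F] N) (k : ℕ) :
    (Nat.card {y : Fin k → M // LinearIndependent F (f ∘ y)} : ℝ) =
      (Fintype.card F : ℝ) ^ (finrank F (LinearMap.ker f) * k) *
        alpha (Fintype.card F) (finrank F (LinearMap.range f)) k := by
  have : Finite (LinearMap.range f) :=
    Finite.of_surjective f.rangeRestrict f.surjective_rangeRestrict
  obtain ⟨g, hg⟩ := f.rangeRestrict.exists_rightInverse_of_surjective f.range_rangeRestrict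
  have hg' : ∀ z, f (g z) = z := fun z => congrArg Subtype.val (LinearMap.congr_fun hg z)
  let e : {y : Fin k → M // LinearIndependent F (f ∘ y)} ≃
      (Fin k → LinearMap.ker f) ×
        {z : Fin k → LinearMap.range f // LinearIndependent F z} :=
    { toFun := fun y => (fun i => ⟨y.1 i - g (f.rangeRestrict (y.1 i)), by
          rw [LinearMap.mem_ker, map_sub, hg']; simp⟩,
        ⟨fun i => f.rangeRestrict (y.1 i),
          LinearIndependent.of_comp (LinearMap.range f).subtype y.2⟩)
      invFun := fun p => ⟨fun i => (p.1 i : M) + g (p.2.1 i), by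
          have h : (f ∘ fun i => (p.1 i : M) + g (p.2.1 i)) =
              (LinearMap.range f).subtype ∘ p.2.1 := by
            funext i
            have := (p.1 i).2
            rw [LinearMap.mem_ker] at this
            simp [hg', this]
          rw [h]
          exact p.2.2.map' _ (Submodule.ker_subtype _)⟩
      left_inv := fun y => by
        ext i
        simp
      right_inv := fun p => by
        have h : ∀ i, f.rangeRestrict ((p.1 i : M) + g (p.2.1 i)) = p.2.1 i := by
          intro i
          have := (p.1 i).2
          rw [LinearMap.mem_ker] at this
          apply Subtype.ext
          simp [hg', this]
        ext i
        · simp only [h]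
          simp
        · simp only [h] }
  rw [Nat.card_congr e, Nat.card_prod, Nat.cast_mul, card_linearIndependent_eq_alpha]
  congr 1
  rw [Nat.card_fun, Nat.card_fin, Module.natCard_eq_pow_finrank (K := F) (V := LinearMap.ker f),
    Nat.card_eq_fintype_card (α := F), ← pow_mul]
  push_cast
  rfl

/-- The `k`-tuples of vectors of `Y` that are linearly independent modulo `A`. -/
def independentTuples (A Y : Submodule F V) (k : ℕ) : Set (Fin k → V) :=
  {y | LinearIndependent F (A.mkQ ∘ y) ∧ ∀ i, y i ∈ Y}

lemma ncard_independentTuples (A Y : Submodule F V) (k : ℕ) :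
    ((independentTuples A Y k).ncard : ℝ) =
      (Fintype.card F : ℝ) ^ (finrank F ↥(A ⊓ Y) * k) *
        alpha (Fintype.card F) (finrank F Y - finrank F ↥(A ⊓ Y)) k := by
  have h1 : independentTuples A Y k = Set.range
      (fun (y : {y : Fin k → Y // LinearIndependent F ((A.mkQ ∘ₗ Y.subtype) ∘ y)}) (i : Fin k) =>
        (y.1 i : V)) := by
    ext y
    constructor
    · rintro ⟨hy, hY⟩
      exact ⟨⟨fun i => ⟨y i, hY i⟩, hy⟩, rfl⟩
    · rintro ⟨y, rfl⟩
      exact ⟨y.2, fun i => (y.1 i).2⟩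
  have hinj : Function.Injective
      (fun (y : {y : Fin k → Y // LinearIndependent F ((A.mkQ ∘ₗ Y.subtype) ∘ y)}) (i : Fin k) =>
        (y.1 i : V)) := by
    intro y z h
    ext i
    exact congrFun h i
  have hker : finrank F (LinearMap.ker (A.mkQ ∘ₗ Y.subtype)) = finrank F ↥(A ⊓ Y) := by
    rw [LinearMap.ker_comp, Submodule.ker_mkQ, ← Submodule.finrank_map_subtype_eq Y,
      Submodule.map_comap_subtype, inf_comm]
  have hrn := LinearMap.finrank_range_add_finrank_ker (A.mkQ ∘ₗ Y.subtype)
  rw [hker] at hrn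
  rw [h1, ← Nat.card_coe_set_eq, Nat.card_range_of_injective hinj,
    card_linearIndependent_comp, hker]
  congr 2
  omega

lemma ncard_independentTuples_bot (Y : Submodule F V) (k : ℕ) :
    ((independentTuples ⊥ Y k).ncard : ℝ) = alpha (Fintype.card F) (finrank F Y) k := by
  rw [ncard_independentTuples, bot_inf_eq, finrank_bot]
  simp

omit [Fintype F] [Finite V] in
lemma linearIndependent_mkQ_bot {k : ℕ} {x : Fin k → V} :
    LinearIndependent F ((⊥ : Submodule F V).mkQ ∘ x) ↔ LinearIndependent F x :=
  LinearMap.linearIndependent_iff _ (Submodule.ker_mkQ _)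

omit [Fintype F] in
lemma span_sup_span_of_independentTuples {A : Submodule F V} {t k : ℕ} {x : Fin t → V}
    {y : Fin k → V} (hx : x ∈ independentTuples ⊥ A t) (hy : y ∈ independentTuples A ⊤ k) :
    finrank F ↥(Submodule.span F (Set.range x) ⊔ Submodule.span F (Set.range y)) = t + k ∧
      finrank F ↥(A ⊓ (Submodule.span F (Set.range x) ⊔ Submodule.span F (Set.range y))) = t := by
  have hx1 := linearIndependent_mkQ_bot.1 hx.1
  have hy1 : LinearIndependent F y := LinearIndependent.of_comp A.mkQ hy.1
  have hxA : Submodule.span F (Set.range x) ≤ A :=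
    Submodule.span_le.2 (Set.range_subset_iff.2 hx.2)
  have hd : Disjoint (Submodule.span F (Set.range y)) A := by
    have := Submodule.range_ker_disjoint hy.1
    rwa [Submodule.ker_mkQ] at this
  have hfx := finrank_span_eq_card hx1
  have hfy := finrank_span_eq_card hy1
  rw [Fintype.card_fin] at hfx hfy
  refine ⟨?_, ?_⟩
  · rw [← finrank_of_disjoint_sup rfl (hd.symm.mono_left hxA), hfx, hfy]
  -- The modular law: the span of `x` lies in `A`, that of `y` meets `A` trivially.
  · rw [inf_comm, sup_inf_assoc_of_le _ hxA, hd.eq_bot, sup_bot_eq, hfx]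

/-- The number of subspaces that meet `A` in dimension `t` and have dimension `t + k`. -/
lemma ncard_subspaces_mul (A : Submodule F V) (t k : ℕ) :
    ({Y : Submodule F V | finrank F Y = t + k ∧ finrank F ↥(A ⊓ Y) = t}.ncard : ℝ) *
        (alpha (Fintype.card F) t t * ((Fintype.card F : ℝ) ^ (t * k) *
          alpha (Fintype.card F) k k)) =
      alpha (Fintype.card F) (finrank F A) t * ((Fintype.card F : ℝ) ^ (finrank F A * k) *
        alpha (Fintype.card F) (finrank F V - finrank F A) k) := by
  classical
  have : Finite (Submodule F V) := Finite.of_injective _ SetLike.coe_injective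
  have := Fintype.ofFinite (Submodule F V)
  have := Fintype.ofFinite V
  let s : Finset ((Fin t → V) × (Fin k → V)) :=
    (independentTuples ⊥ A t ×ˢ independentTuples A ⊤ k).toFinset
  let T : Finset (Submodule F V) :=
    {Y : Submodule F V | finrank F Y = t + k ∧ finrank F ↥(A ⊓ Y) = t}.toFinset
  have key := Finset.sum_card_bipartiteAbove_eq_sum_card_bipartiteBelow (s := s) (t := T)
    (fun p Y => (∀ i, p.1 i ∈ Y) ∧ ∀ i, p.2 i ∈ Y)
  -- Double counting of incidences: each admissible pair of tuples spans exactly one `Y`, and each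
  -- `Y` contains the same number of such pairs.
  have h1 : ∀ p ∈ s, (T.bipartiteAbove
      (fun p Y => (∀ i, p.1 i ∈ Y) ∧ ∀ i, p.2 i ∈ Y) p).card = 1 := by
    rintro ⟨x, y⟩ hp
    simp only [s, Set.mem_toFinset, Set.mem_prod] at hp
    obtain ⟨hx, hy⟩ := hp
    obtain ⟨h1, h2⟩ := span_sup_span_of_independentTuples hx hy
    rw [Finset.card_eq_one]
    refine ⟨Submodule.span F (Set.range x) ⊔ Submodule.span F (Set.range y), ?_⟩
    ext Y
    simp only [Finset.mem_bipartiteAbove, T, Set.mem_toFinset, Set.mem_ofPred_eq,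
      Finset.mem_singleton]
    constructor
    · rintro ⟨⟨h3, -⟩, h4, h5⟩
      refine (Submodule.eq_of_le_of_finrank_eq (sup_le ?_ ?_) (h1.trans h3.symm)).symm
      · exact Submodule.span_le.2 (Set.range_subset_iff.2 h4)
      · exact Submodule.span_le.2 (Set.range_subset_iff.2 h5)
    · rintro rfl
      exact ⟨⟨h1, h2⟩, fun i => Submodule.mem_sup_left (Submodule.subset_span ⟨i, rfl⟩),
        fun i => Submodule.mem_sup_right (Submodule.subset_span ⟨i, rfl⟩)⟩
  have h2 : ∀ Y ∈ T, ((s.bipartiteBelow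
      (fun p Y => (∀ i, p.1 i ∈ Y) ∧ ∀ i, p.2 i ∈ Y) Y).card : ℝ) =
      alpha (Fintype.card F) t t * ((Fintype.card F : ℝ) ^ (t * k) *
          alpha (Fintype.card F) k k) := by
    intro Y hY
    simp only [T, Set.mem_toFinset, Set.mem_ofPred_eq] at hY
    have h3 : s.bipartiteBelow (fun p Y => (∀ i, p.1 i ∈ Y) ∧ ∀ i, p.2 i ∈ Y) Y =
        (independentTuples ⊥ (A ⊓ Y) t ×ˢ independentTuples A Y k).toFinset := by
      ext p
      rw [Finset.mem_bipartiteBelow, Set.mem_toFinset, Set.mem_toFinset]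
      constructor
      · rintro ⟨⟨⟨h4, h5⟩, h6, -⟩, h7, h8⟩
        exact ⟨⟨h4, fun i => ⟨h5 i, h7 i⟩⟩, h6, h8⟩
      · rintro ⟨⟨h4, h5⟩, h6, h8⟩
        exact ⟨⟨⟨h4, fun i => (h5 i).1⟩, h6, fun i => trivial⟩, fun i => (h5 i).2, h8⟩
    rw [h3, ← Set.ncard_eq_toFinset_card', Set.ncard_prod, Nat.cast_mul,
      ncard_independentTuples_bot, ncard_independentTuples, hY.1, hY.2, Nat.add_sub_cancel_left]
  rw [Finset.sum_congr rfl h1, Finset.sum_const, smul_eq_mul, mul_one] at key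
  have key' := congrArg (Nat.cast : ℕ → ℝ) key
  rw [Nat.cast_sum, Finset.sum_congr rfl h2, Finset.sum_const, nsmul_eq_mul,
    ← Set.ncard_eq_toFinset_card', ← Set.ncard_eq_toFinset_card', Set.ncard_prod, Nat.cast_mul,
    ncard_independentTuples_bot, ncard_independentTuples, inf_top_eq, finrank_top] at key'
  exact key'.symm

/-- The number of subspaces of dimension `t` is a Gaussian binomial coefficient. -/
lemma ncard_subspaces (t : ℕ) :
    ({Y : Submodule F V | finrank F Y = t}.ncard : ℝ) =
      gaussBinom (Fintype.card F) (finrank F V) t := by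
  have h := ncard_subspaces_mul (⊤ : Submodule F V) t 0
  have hset : {Y : Submodule F V | finrank F Y = t + 0 ∧ finrank F ↥(⊤ ⊓ Y) = t} =
      {Y : Submodule F V | finrank F Y = t} := by
    ext Y
    rw [Set.mem_ofPred_eq, Set.mem_ofPred_eq, top_inf_eq, add_zero, and_self]
  rw [hset] at h
  simp only [mul_zero, pow_zero, alpha_zero, mul_one,
    finrank_top] at h
  rw [gaussBinom, eq_div_iff (alpha_pos Fintype.one_lt_card le_rfl).ne', h]

end Tuples

/-! ### Closed form for the sizes of spheres -/

section NSFormula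

variable {F : Type*} [Field F] [Fintype F]

omit [Fintype F] in
lemma exists_subspace_finrank {n a : ℕ} (h : a ≤ n) : ∃ A : Subspaces F n, finrank F A = a := by
  obtain ⟨f, hf⟩ := exists_linearIndependent_of_le_finrank (R := F) (M := Fin n → F) (n := a)
    (by rwa [finrank_fin_fun])
  exact ⟨Submodule.span F (Set.range f), by rw [finrank_span_eq_card hf, Fintype.card_fin]⟩

lemma NS_eq {n t j : ℕ} (h : t + j ≤ n) (k : ℕ) :
    (NS F n (t + j) (t + k) (j + k) : ℝ) =
      (Fintype.card F : ℝ) ^ (j * k) * gaussBinom (Fintype.card F) (t + j) t *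
        gaussBinom (Fintype.card F) (n - (t + j)) k := by
  obtain ⟨A, hA⟩ := exists_subspace_finrank (F := F) h
  have hs : sphere A (t + k) (j + k) =
      {Y : Subspaces F n | finrank F Y = t + k ∧ finrank F ↥(A ⊓ Y) = t} := by
    ext Y
    have h1 := subspaceDist_add A Y
    rw [mem_sphere, Set.mem_ofPred_eq]
    constructor <;> rintro ⟨h2, h3⟩ <;> exact ⟨h2, by omega⟩
  have h1 := ncard_subspaces_mul A t k
  have hq : 1 < Fintype.card F := Fintype.one_lt_card
  have ht := alpha_pos hq (le_refl t)
  have hk := alpha_pos hq (le_refl k)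
  have hp : (0 : ℝ) < (Fintype.card F : ℝ) ^ (t * k) := pow_pos (by positivity) _
  have h2 := NS_eq_ncard A (t + k) (j + k)
  rw [hA] at h2
  rw [h2, hs, gaussBinom, gaussBinom]
  rw [hA, finrank_fin_fun, add_mul t j k, pow_add] at h1
  field_simp
  have h3 : (Fintype.card F : ℝ) ^ (t * k) *
    ({Y : Subspaces F n | finrank F Y = t + k ∧ finrank F ↥(A ⊓ Y) = t}.ncard *
      alpha (Fintype.card F) t t * alpha (Fintype.card F) k k) =
    (Fintype.card F : ℝ) ^ (t * k) * ((Fintype.card F : ℝ) ^ (j * k) *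
      alpha (Fintype.card F) (t + j) t * alpha (Fintype.card F) (n - (t + j)) k) := by
    linarith
  exact mul_left_cancel₀ hp.ne' h3

end NSFormula

/-! ### Rank metric codes and their liftings -/

section RankMetric

variable {F : Type*} [Field F] [Fintype F] {V W : Type*} [AddCommGroup V] [Module F V] [Finite V]
  [AddCommGroup W] [Module F W] [Finite W]

omit [Fintype F] [Finite W] in
-- The map `f - g` vanishes on `K` and on `z`, hence on a space of dimension `(dim V - w) + (w - d +
-- 1)`. Its rank is then at most `d - 1`.
lemma eq_of_ker_eq_of_comp_eq {d w : ℕ} {f g : V →ₗ[F] W}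
    (hfg : f ≠ g → d ≤ finrank F (LinearMap.range (f - g))) (hdw : d ≤ w)
    {K : Submodule F V} (hK : finrank F K + w = finrank F V)
    (hf : LinearMap.ker f = K) (hg : LinearMap.ker g = K) {z : Fin (w - d + 1) → V}
    (hz : LinearIndependent F (K.mkQ ∘ z)) (h : f ∘ z = g ∘ z) : f = g := by
  by_contra hne
  have h1 := hfg hne
  have hdisj : Disjoint (Submodule.span F (Set.range z)) K := by
    have := Submodule.range_ker_disjoint hz
    rwa [Submodule.ker_mkQ] at this
  have h2 := finrank_of_disjoint_sup rfl hdisj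
  rw [finrank_span_eq_card (LinearIndependent.of_comp K.mkQ hz), Fintype.card_fin] at h2
  have h3 : Submodule.span F (Set.range z) ⊔ K ≤ LinearMap.ker (f - g) := by
    refine sup_le (Submodule.span_le.2 (Set.range_subset_iff.2 fun i => ?_)) fun x hx => ?_
    · have := congrFun h i
      simp only [Function.comp_apply] at this
      simp [this]
    · have hfx : f x = 0 := by rwa [← hf] at hx
      have hgx : g x = 0 := by rwa [← hg] at hx
      simp [hfx, hgx]
  have h4 := Submodule.finrank_mono h3
  have h5 := LinearMap.finrank_range_add_finrank_ker (f - g)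
  omega

/-- A set of linear maps of rank `w` at mutual rank distance at least `d`. -/
lemma ncard_rankMetric_le {d w : ℕ} (hd : 1 ≤ d) (hdw : d ≤ w) (S : Set (V →ₗ[F] W))
    (hw : ∀ f ∈ S, finrank F (LinearMap.range f) = w)
    (hS : ∀ f ∈ S, ∀ g ∈ S, f ≠ g → d ≤ finrank F (LinearMap.range (f - g))) :
    (S.ncard : ℝ) ≤ gaussBinom (Fintype.card F) (finrank F V) w *
      alpha (Fintype.card F) (finrank F W) (w - d + 1) := by
  classical
  have hq : 1 < Fintype.card F := Fintype.one_lt_card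
  have hn : 0 ≤ gaussBinom (Fintype.card F) (finrank F V) w *
      alpha (Fintype.card F) (finrank F W) (w - d + 1) :=
    mul_nonneg (gaussBinom_nonneg hq) (alpha_nonneg hq)
  have : Finite (V →ₗ[F] W) := DFunLike.finite _
  have : Finite (Submodule F V) := Finite.of_injective _ SetLike.coe_injective
  -- The trivial case is split off so that `finrank F V - w` below is a genuine subtraction.
  rcases lt_or_ge (finrank F V) w with hwV | hwV
  · have hempty : S = ∅ := by
      refine Set.eq_empty_of_forall_notMem fun f hf => ?_
      have h1 := hw f hf
      have h2 := LinearMap.finrank_range_add_finrank_ker f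
      omega
    rwa [hempty, Set.ncard_empty, Nat.cast_zero]
  have hSf := S.toFinite
  have hTf := ({K : Submodule F V | finrank F K = finrank F V - w}).toFinite
  have hker : ∀ f ∈ hSf.toFinset, LinearMap.ker f ∈ hTf.toFinset := by
    intro f hf
    rw [Set.Finite.mem_toFinset] at hf ⊢
    have h1 := hw f hf
    have h2 := LinearMap.finrank_range_add_finrank_ker f
    rw [Set.mem_ofPred_eq]
    omega
  -- For a fixed kernel, evaluation at `w - d + 1` vectors independent modulo `K` embeds the maps
  -- into the independent tuples of `W`.
  have hfib : ∀ K ∈ hTf.toFinset, (hSf.toFinset.filter fun f => LinearMap.ker f = K).card ≤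
      Nat.card {s : Fin (w - d + 1) → W // LinearIndependent F s} := by
    intro K hK
    rw [Set.Finite.mem_toFinset, Set.mem_ofPred_eq] at hK
    obtain ⟨z', hz'⟩ := exists_linearIndependent_of_le_finrank (R := F) (M := V ⧸ K)
      (n := w - d + 1) (by rw [Submodule.finrank_quotient]; omega)
    choose z hz using fun i => K.mkQ_surjective (z' i)
    have hz1 : LinearIndependent F (K.mkQ ∘ z) := by
      have : K.mkQ ∘ z = z' := funext hz
      rwa [this]
    have hli : ∀ f : V →ₗ[F] W, LinearMap.ker f = K → LinearIndependent F (f ∘ z) := by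
      intro f hf
      have h1 : f ∘ z = K.liftQ f hf.ge ∘ (K.mkQ ∘ z) := by
        funext i
        simp
      rw [h1]
      exact hz1.map' _ (Submodule.ker_liftQ_eq_bot' _ _ hf.symm)
    let φ : (hSf.toFinset.filter fun f => LinearMap.ker f = K) →
        {s : Fin (w - d + 1) → W // LinearIndependent F s} :=
      fun f => ⟨f.1 ∘ z, hli f.1 (Finset.mem_filter.1 f.2).2⟩
    have hφ : Function.Injective φ := by
      intro f g hfg
      have hf := Finset.mem_filter.1 f.2
      have hg := Finset.mem_filter.1 g.2
      rw [Set.Finite.mem_toFinset] at hf hg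
      exact Subtype.ext (eq_of_ker_eq_of_comp_eq (hS f hf.1 g hg.1) hdw (by omega) hf.2 hg.2 hz1
        (congrArg Subtype.val hfg))
    have h1 := Nat.card_le_card_of_injective φ hφ
    rwa [Nat.card_eq_fintype_card, Fintype.card_coe] at h1
  -- Fibre bound times number of possible kernels; the latter is a Gaussian binomial, rewritten by
  -- symmetry.
  have h1 := Finset.card_le_mul_card_image_of_maps_to hker _ hfib
  rw [← Set.ncard_eq_toFinset_card, ← Set.ncard_eq_toFinset_card] at h1
  have h2 := (Nat.cast_le (α := ℝ)).2 h1
  rw [Nat.cast_mul, card_linearIndependent_eq_alpha, ncard_subspaces, mul_comm] at h2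
  have h3 := gaussBinom_symm hq (finrank F V - w) w
  rw [Nat.sub_add_cancel hwV] at h3
  rwa [h3] at h2

end RankMetric

/-! ### Subspace distance of liftings and rank distance -/

section Lifting

variable {F : Type*} [Field F] {n r : ℕ}

lemma vecMul_liftMatrix_left (h : r ≤ n) (M : Matrix (Fin r) (Fin (n - r)) F) (x : Fin r → F)
    (j : Fin r) : Matrix.vecMul x (liftMatrix M) (Fin.castLE h j) = x j := by
  simp [Matrix.vecMul, dotProduct, liftMatrix, Fin.val_inj]

lemma vecMul_liftMatrix_right (h : r ≤ n) (M : Matrix (Fin r) (Fin (n - r)) F) (x : Fin r → F)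
    (j : Fin (n - r)) :
    Matrix.vecMul x (liftMatrix M) ⟨r + j, by omega⟩ = Matrix.vecMul x M j := by
  simp [Matrix.vecMul, dotProduct, liftMatrix]

lemma lift_eq_range (M : Matrix (Fin r) (Fin (n - r)) F) :
    lift M = LinearMap.range (liftMatrix M).vecMulLinear :=
  (range_vecMulLinear _).symm

lemma vecMulLinear_liftMatrix_injective (h : r ≤ n) (M : Matrix (Fin r) (Fin (n - r)) F) :
    Function.Injective (liftMatrix M).vecMulLinear := by
  intro x y hxy
  funext j
  have := congrFun hxy (Fin.castLE h j)
  simpa only [Matrix.vecMulLinear_apply, vecMul_liftMatrix_left h] using this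

lemma finrank_lift (h : r ≤ n) (M : Matrix (Fin r) (Fin (n - r)) F) : finrank F (lift M) = r := by
  rw [lift_eq_range, LinearMap.finrank_range_of_inj (vecMulLinear_liftMatrix_injective h M),
    finrank_fin_fun]

/-- The first `r` coordinates of `x (I | M)` recover `x`, so a common vector comes from the same `x`
in both row spaces, with `x M = x N`. -/
lemma lift_inf_lift (h : r ≤ n) (M N : Matrix (Fin r) (Fin (n - r)) F) :
    lift M ⊓ lift N =
      (LinearMap.ker (M - N).vecMulLinear).map (liftMatrix M).vecMulLinear := by
  ext y
  simp only [lift_eq_range, Submodule.mem_inf, LinearMap.mem_range, Submodule.mem_map,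
    LinearMap.mem_ker, Matrix.vecMulLinear_apply, Matrix.vecMul_sub]
  constructor
  · rintro ⟨⟨x, rfl⟩, x', hx'⟩
    have hx : x' = x := by
      funext j
      have := congrFun hx' (Fin.castLE h j)
      rwa [vecMul_liftMatrix_left, vecMul_liftMatrix_left] at this
    subst hx
    refine ⟨x', sub_eq_zero.2 ?_, rfl⟩
    funext j
    rw [← vecMul_liftMatrix_right h, ← vecMul_liftMatrix_right h, hx']
  · rintro ⟨x, hx, rfl⟩
    refine ⟨⟨x, rfl⟩, x, ?_⟩
    rw [sub_eq_zero] at hx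
    funext j
    rcases lt_or_ge (j : ℕ) r with hj | hj
    · have : j = Fin.castLE h ⟨j, hj⟩ := rfl
      rw [this, vecMul_liftMatrix_left, vecMul_liftMatrix_left]
    · have : j = ⟨r + (⟨j - r, by omega⟩ : Fin (n - r)), by
          have := j.isLt
          simp only
          omega⟩ := by
        ext
        simp only
        omega
      rw [this, vecMul_liftMatrix_right h, vecMul_liftMatrix_right h, hx]

/-- The subspace distance of liftings is twice the rank distance. -/
lemma subspaceDist_lift (h : r ≤ n) (M N : Matrix (Fin r) (Fin (n - r)) F) :
    subspaceDist (lift M) (lift N) = 2 * finrank F (LinearMap.range (M - N).vecMulLinear) := by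
  have h1 := subspaceDist_add (lift M) (lift N)
  have h2 : finrank F ↥(lift M ⊓ lift N) = finrank F (LinearMap.ker (M - N).vecMulLinear) := by
    rw [lift_inf_lift h]
    exact (Submodule.equivMapOfInjective _
      (vecMulLinear_liftMatrix_injective h M) _).finrank_eq.symm
  have h3 := LinearMap.finrank_range_add_finrank_ker (M - N).vecMulLinear
  rw [finrank_fin_fun] at h3
  rw [finrank_lift h, finrank_lift h, h2] at h1
  omega

/-- Translation by the matrix of `C` preserves differences and turns the codewords at distance `2w`
into maps of rank `w`, to which `ncard_rankMetric_le` applies. -/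
lemma distDistr_lift_le [Fintype F] {d w : ℕ} (h : r ≤ n) (hd : 1 ≤ d) (hdw : d ≤ w)
    {R : Set (Matrix (Fin r) (Fin (n - r)) F)} (hR : IsCDC (lift '' R) r (2 * d))
    {C : Subspaces F n} (hC : C ∈ lift '' R) :
    (distDistr (lift '' R) C w : ℝ) ≤ gaussBinom (Fintype.card F) r w *
      alpha (Fintype.card F) (n - r) (w - d + 1) := by
  obtain ⟨M₀, hM₀, rfl⟩ := hC
  have : Finite (Matrix (Fin r) (Fin (n - r)) F) :=
    inferInstanceAs (Finite (Fin r → Fin (n - r) → F))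
  let S : Set ((Fin r → F) →ₗ[F] (Fin (n - r) → F)) :=
    (fun M => (M - M₀).vecMulLinear) '' {M | M ∈ R ∧
      finrank F (LinearMap.range (M - M₀).vecMulLinear) = w}
  have hsub : ∀ M N : Matrix (Fin r) (Fin (n - r)) F,
      (M - M₀).vecMulLinear - (N - M₀).vecMulLinear = (M - N).vecMulLinear := by
    intro M N
    ext x j
    simp
  have hinj : Function.Injective fun M : Matrix (Fin r) (Fin (n - r)) F =>
      (M - M₀).vecMulLinear := by
    intro M N hMN
    have h1 : (M - N).vecMulLinear = 0 := by
      rw [← hsub, sub_eq_zero]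
      exact hMN
    rw [← sub_eq_zero]
    exact (Matrix.toLinearMapRight' (R := F)).injective (h1.trans (map_zero _).symm)
  have h1 : distDistr (lift '' R) (lift M₀) w ≤ S.ncard := by
    rw [Set.ncard_image_of_injective _ hinj, distDistr]
    refine (Set.ncard_le_ncard ?_ (Set.toFinite _)).trans
      (Set.ncard_image_le (f := lift) (Set.toFinite _))
    rintro D ⟨⟨M, hM, rfl⟩, hD⟩
    rw [subspaceDist_lift h] at hD
    exact ⟨M, ⟨hM, by omega⟩, rfl⟩
  have h2 := ncard_rankMetric_le hd hdw S (by
      rintro f ⟨M, hM, rfl⟩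
      exact hM.2) (by
      rintro f ⟨M, hM, rfl⟩ g ⟨N, hN, rfl⟩ hne
      simp only
      rw [hsub]
      have h3 := subspaceDist_lift h M N
      have h4 : lift M ≠ lift N := by
        intro heq
        rw [heq, subspaceDist_self] at h3
        have h5 : finrank F (LinearMap.range (M - N).vecMulLinear) = 0 := by omega
        rw [Submodule.finrank_eq_zero, LinearMap.range_eq_bot, ← hsub, sub_eq_zero] at h5
        exact hne h5
      have h5 := hR.le_dist _ ⟨M, hM.1, rfl⟩ _ ⟨N, hN.1, rfl⟩ h4
      omega)
  rw [finrank_fin_fun, finrank_fin_fun] at h2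
  exact (Nat.cast_le.2 h1).trans h2

end Lifting

/-! ### The constants `K_q` and `L_q` and estimates for Gaussian binomials -/

section Constants

variable {q : ℕ}

lemma summable_inv_pow_succ (hq : 1 < q) : Summable fun j : ℕ => ((q : ℝ) ^ (j + 1))⁻¹ := by
  have hq' : (1 : ℝ) < q := by exact_mod_cast hq
  have h := (summable_nat_add_iff 1).2
    (summable_geometric_of_lt_one (r := (q : ℝ)⁻¹) (by positivity) (inv_lt_one_of_one_lt₀ hq'))
  refine h.congr fun j => ?_
  rw [inv_pow]

lemma one_sub_inv_pow_mem (hq : 1 < q) (j : ℕ) :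
    0 < 1 - ((q : ℝ) ^ (j + 1))⁻¹ ∧ 1 - ((q : ℝ) ^ (j + 1))⁻¹ ≤ 1 := by
  have hq' : (1 : ℝ) < q := by exact_mod_cast hq
  have h := inv_lt_one_of_one_lt₀ (one_lt_pow₀ hq' j.add_one_ne_zero)
  have h0 : 0 < ((q : ℝ) ^ (j + 1))⁻¹ := by positivity
  constructor <;> linarith

lemma tendsto_K (hq : 1 < q) :
    Filter.Tendsto (fun k => ∏ j ∈ Finset.range k, (1 - ((q : ℝ) ^ (j + 1))⁻¹)) Filter.atTop
      (nhds (K q)) := by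
  have h : Multipliable fun j : ℕ => 1 + -((q : ℝ) ^ (j + 1))⁻¹ :=
    multipliable_one_add_of_summable ((summable_inv_pow_succ hq).neg.norm)
  simp only [← sub_eq_add_neg] at h
  exact h.hasProd.tendsto_prod_nat

lemma K_le (hq : 1 < q) (k : ℕ) :
    K q ≤ ∏ j ∈ Finset.range k, (1 - ((q : ℝ) ^ (j + 1))⁻¹) := by
  refine Antitone.le_of_tendsto (antitone_nat_of_succ_le fun k => ?_) (tendsto_K hq) k
  rw [Finset.prod_range_succ]
  exact mul_le_of_le_one_right (Finset.prod_nonneg fun j _ => (one_sub_inv_pow_mem hq j).1.le)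
    (one_sub_inv_pow_mem hq k).2

lemma K_pos (hq : 1 < q) : 0 < K q := by
  have h0 : 0 ≤ K q :=
    ge_of_tendsto' (tendsto_K hq)
      fun k => Finset.prod_nonneg fun j _ => (one_sub_inv_pow_mem hq j).1.le
  refine lt_of_le_of_ne h0 (Ne.symm ?_)
  -- Positive partial products only give a nonnegative limit; that it does not vanish uses the
  -- summability of `q^{-j}`.
  have h := tprod_one_add_ne_zero_of_summable (f := fun j : ℕ => -((q : ℝ) ^ (j + 1))⁻¹)
    (fun j => by rw [← sub_eq_add_neg]; exact (one_sub_inv_pow_mem hq j).1.ne')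
    ((summable_inv_pow_succ hq).neg.norm)
  simp only [← sub_eq_add_neg] at h
  exact h

lemma summable_L (hq : 1 < q) :
    Summable fun i : ℕ => (q : ℝ) ^ (-(3 / 4 * (i : ℝ) ^ 2)) := by
  have hq' : (1 : ℝ) < q := by exact_mod_cast hq
  have hr : (q : ℝ) ^ (-(3 / 4 : ℝ)) < 1 := Real.rpow_lt_one_of_one_lt_of_neg hq' (by norm_num)
  refine Summable.of_nonneg_of_le (fun i => Real.rpow_nonneg (by positivity) _) (fun i => ?_)
    (summable_geometric_of_lt_one (Real.rpow_nonneg (by positivity) (-(3 / 4 : ℝ))) hr)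
  rw [← Real.rpow_mul_natCast (by positivity)]
  refine Real.rpow_le_rpow_of_exponent_le hq'.le ?_
  have : (i : ℝ) ≤ (i : ℝ) ^ 2 := by
    have : i ≤ i ^ 2 := Nat.le_self_pow two_ne_zero i
    exact_mod_cast this
  linarith

/-- Some index lies outside `S` and contributes a positive term. This is the source of the strict
final bounds. -/
lemma sum_lt_L (hq : 1 < q) (S : Finset ℕ) :
    (K q ^ 2)⁻¹ * ∑ i ∈ S, (q : ℝ) ^ (-(3 / 4 * (i : ℝ) ^ 2)) < L q := by
  have hq' : (0 : ℝ) < q := by exact_mod_cast (zero_lt_one.trans hq)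
  obtain ⟨i, hi⟩ := Infinite.exists_notMem_finset S
  refine mul_lt_mul_of_pos_left ?_ (inv_pos.2 (pow_pos (K_pos hq) 2))
  have h := (summable_L hq).sum_le_tsum (insert i S)
    (fun j _ => Real.rpow_nonneg hq'.le (-(3 / 4 * (j : ℝ) ^ 2)))
  rw [Finset.sum_insert hi] at h
  have := Real.rpow_pos_of_pos hq' (-(3 / 4 * (i : ℝ) ^ 2))
  linarith

lemma L_pos (hq : 1 < q) : 0 < L q := by
  simpa using sum_lt_L hq ∅

lemma alpha_le_pow (hq : 1 < q) {m u : ℕ} (h : u ≤ m) : alpha q m u ≤ (q : ℝ) ^ (m * u) := by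
  have hq' : (1 : ℝ) < q := by exact_mod_cast hq
  have h1 : (q : ℝ) ^ (m * u) = ∏ _i ∈ Finset.range u, (q : ℝ) ^ m := by
    rw [Finset.prod_const, Finset.card_range, pow_mul]
  rw [h1, alpha]
  refine Finset.prod_le_prod (fun i hi => ?_) (fun i _ => ?_)
  · have hi' := Finset.mem_range.1 hi
    exact sub_nonneg.2 (pow_le_pow_right₀ hq'.le (by omega))
  · exact sub_le_self _ (by positivity)

lemma alpha_self (hq : 1 < q) (u : ℕ) :
    alpha q u u = (q : ℝ) ^ (u * u) * ∏ j ∈ Finset.range u, (1 - ((q : ℝ) ^ (j + 1))⁻¹) := by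
  have hq' : (0 : ℝ) < q := by exact_mod_cast (zero_lt_one.trans hq)
  have h1 : (q : ℝ) ^ (u * u) = ∏ _i ∈ Finset.range u, (q : ℝ) ^ u := by
    rw [Finset.prod_const, Finset.card_range, pow_mul]
  rw [h1, ← Finset.prod_mul_distrib, alpha, ← Finset.prod_range_reflect]
  refine Finset.prod_congr rfl fun j hj => ?_
  have hj' := Finset.mem_range.1 hj
  have h2 : (q : ℝ) ^ u = (q : ℝ) ^ (u - 1 - j) * (q : ℝ) ^ (j + 1) := by
    rw [← pow_add]
    congr 1
    omega
  rw [h2]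
  field_simp

/-- The numerator is at most `q^{(u+v)u}`, and the denominator is `q^{u²}` times a partial product
of `K_q`, which exceeds or equals `K_q`. -/
lemma gaussBinom_le (hq : 1 < q) (u v : ℕ) :
    gaussBinom q (u + v) u ≤ (K q)⁻¹ * (q : ℝ) ^ (u * v) := by
  have hq' : (0 : ℝ) < q := by exact_mod_cast (zero_lt_one.trans hq)
  have hK := K_pos hq
  rw [gaussBinom, div_le_iff₀ (alpha_pos hq le_rfl)]
  refine (alpha_le_pow hq (Nat.le_add_right u v)).trans ?_
  rw [alpha_self hq]
  have h1 : (q : ℝ) ^ ((u + v) * u) = (q : ℝ) ^ (u * v) * (q : ℝ) ^ (u * u) := by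
    rw [← pow_add]
    congr 1
    ring
  rw [h1]
  have h2 := K_le hq u
  have h3 : 1 ≤ (K q)⁻¹ * ∏ j ∈ Finset.range u, (1 - ((q : ℝ) ^ (j + 1))⁻¹) := by
    rw [← div_eq_inv_mul, le_div_iff₀ hK, one_mul]
    exact h2
  have h4 : (0 : ℝ) < (q : ℝ) ^ (u * v) * (q : ℝ) ^ (u * u) := by positivity
  calc (q : ℝ) ^ (u * v) * (q : ℝ) ^ (u * u)
      ≤ ((q : ℝ) ^ (u * v) * (q : ℝ) ^ (u * u)) *
          ((K q)⁻¹ * ∏ j ∈ Finset.range u, (1 - ((q : ℝ) ^ (j + 1))⁻¹)) :=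
        le_mul_of_one_le_right h4.le h3
    _ = _ := by ring

/-- After normalising by powers of `q`, the first `a` factors of `α(a+c, a+c)` are at most `1`, and
its last `c` factors `1 - q^{a+i-(a+c)}` are at most `1 - q^{a+i-m}`. -/
lemma alpha_mul_le (hq : 1 < q) {m a c : ℕ} (h : a + c ≤ m) :
    alpha q m a * (q : ℝ) ^ (m * c) * alpha q (a + c) (a + c) ≤
      (q : ℝ) ^ ((a + c) * (a + c)) * alpha q m (a + c) := by
  have hq' : (1 : ℝ) < q := by exact_mod_cast hq
  have hq0 : (0 : ℝ) < q := by linarith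
  have h1 : alpha q m (a + c) =
      alpha q m a * ∏ i ∈ Finset.range c, ((q : ℝ) ^ m - (q : ℝ) ^ (a + i)) :=
    Finset.prod_range_add _ _ _
  have h2 : alpha q (a + c) (a + c) =
      alpha q (a + c) a * ∏ i ∈ Finset.range c, ((q : ℝ) ^ (a + c) - (q : ℝ) ^ (a + i)) :=
    Finset.prod_range_add _ _ _
  have h3 := alpha_le_pow hq (Nat.le_add_right a c)
  have h4 : (q : ℝ) ^ (m * c) * ∏ i ∈ Finset.range c, ((q : ℝ) ^ (a + c) - (q : ℝ) ^ (a + i)) ≤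
      (q : ℝ) ^ ((a + c) * c) * ∏ i ∈ Finset.range c, ((q : ℝ) ^ m - (q : ℝ) ^ (a + i)) := by
    have h5 : ∀ b : ℕ, (q : ℝ) ^ (b * c) = ∏ _i ∈ Finset.range c, (q : ℝ) ^ b := by
      intro b
      rw [Finset.prod_const, Finset.card_range, pow_mul]
    rw [h5, h5, ← Finset.prod_mul_distrib, ← Finset.prod_mul_distrib]
    refine Finset.prod_le_prod (fun i hi => ?_) (fun i _ => ?_)
    · have hi' := Finset.mem_range.1 hi
      exact mul_nonneg (by positivity)
        (sub_nonneg.2 (pow_le_pow_right₀ hq'.le (by omega)))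
    · have h6 : (q : ℝ) ^ (a + c) * (q : ℝ) ^ (a + i) ≤ (q : ℝ) ^ m * (q : ℝ) ^ (a + i) :=
        mul_le_mul_of_nonneg_right (pow_le_pow_right₀ hq'.le h) (by positivity)
      linarith
  have h5 : (0 : ℝ) ≤ (q : ℝ) ^ (m * c) *
      ∏ i ∈ Finset.range c, ((q : ℝ) ^ (a + c) - (q : ℝ) ^ (a + i)) := by
    refine mul_nonneg (by positivity) (Finset.prod_nonneg fun i hi => ?_)
    have hi' := Finset.mem_range.1 hi
    exact sub_nonneg.2 (pow_le_pow_right₀ hq'.le (by omega))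
  have h6 := mul_le_mul h3 h4 h5 (by positivity)
  have h7 := mul_le_mul_of_nonneg_left h6 (alpha_nonneg (m := m) (u := a) hq)
  have h8 : (q : ℝ) ^ ((a + c) * (a + c)) = (q : ℝ) ^ ((a + c) * a) * (q : ℝ) ^ ((a + c) * c) := by
    rw [← pow_add, Nat.mul_add]
  rw [h1, h2, h8]
  linarith

end Constants

/-! ### The bound on the decoder error probability -/

section Bound

variable {F : Type*} [Field F] [Fintype F] {n : ℕ}

/-- Double counting of the pairs of subspaces at given distances from each other and from a given
subspace. -/
lemma sum_NS_mul_JS_le {r v : ℕ} (hr : r ≤ n) (u s d : ℕ) :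
    ∑ w ∈ Finset.Icc d r, NS F n r r (2 * w) * JS F n u s (2 * w) r r v ≤
      NS F n r v u * NS F n v r s := by
  classical
  obtain ⟨C, hC⟩ := exists_subspace_finrank (F := F) hr
  have := Fintype.ofFinite (Subspaces F n)
  let Y₀ : Finset (Subspaces F n) := (sphere C v u).toFinset
  let D₀ : Finset (Subspaces F n) := Finset.univ.filter fun D => finrank F D = r
  -- The pairs counted are `(Y, D)` with `Y` on the sphere of `C` and `D` of dimension `r` at
  -- distance `s` from `Y`.
  have key := Finset.sum_card_bipartiteAbove_eq_sum_card_bipartiteBelow (s := Y₀) (t := D₀)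
    (fun Y D => subspaceDist Y D = s)
  have h1 : ∀ Y ∈ Y₀, (D₀.bipartiteAbove (fun Y D => subspaceDist Y D = s) Y).card =
      NS F n v r s := by
    intro Y hY
    have hY' := Set.mem_toFinset.1 hY
    have h2 := NS_eq_ncard Y r s
    rw [hY'.1] at h2
    rw [h2, Set.ncard_eq_toFinset_card']
    congr 1
    ext D
    rw [Finset.mem_bipartiteAbove, Finset.mem_filter, Set.mem_toFinset, mem_sphere]
    simp
  rw [Finset.sum_congr rfl h1, Finset.sum_const, smul_eq_mul] at key
  have h2 : Y₀.card = NS F n r v u := by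
    rw [← hC, NS_eq_ncard, Set.ncard_eq_toFinset_card']
  rw [h2] at key
  rw [key]
  have h3 : ∀ w ∈ Finset.Icc d r, NS F n r r (2 * w) * JS F n u s (2 * w) r r v =
      ∑ D ∈ D₀.filter (fun D => subspaceDist C D = 2 * w),
        (Y₀.bipartiteBelow (fun Y D => subspaceDist Y D = s) D).card := by
    intro w _
    have h4 : (D₀.filter (fun D => subspaceDist C D = 2 * w)).card = NS F n r r (2 * w) := by
      have h5 := NS_eq_ncard C r (2 * w)
      rw [hC] at h5
      rw [h5, Set.ncard_eq_toFinset_card']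
      congr 1
      ext D
      rw [Finset.mem_filter, Finset.mem_filter, Set.mem_toFinset, mem_sphere]
      simp
    rw [← h4, ← smul_eq_mul, ← Finset.sum_const]
    refine Finset.sum_congr rfl fun D hD => ?_
    rw [Finset.mem_filter, Finset.mem_filter] at hD
    have h5 := JS_eq_ncard (A := C) (B := D) u s v
    rw [hC, hD.1.2, hD.2] at h5
    rw [h5, Set.ncard_eq_toFinset_card']
    congr 1
    ext Y
    rw [Finset.mem_bipartiteBelow, Set.mem_toFinset, Set.mem_toFinset, Set.mem_inter_iff,
      mem_sphere, mem_sphere, subspaceDist_comm D Y]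
    tauto
  rw [Finset.sum_congr rfl h3, ← Finset.sum_biUnion]
  · refine Finset.sum_le_sum_of_subset ?_
    intro D hD
    rw [Finset.mem_biUnion] at hD
    obtain ⟨w, -, hD⟩ := hD
    exact (Finset.mem_filter.1 hD).1
  · intro w _ w' _ hww
    simp only [Function.onFun, Finset.disjoint_left, Finset.mem_filter]
    rintro D ⟨-, h⟩ ⟨-, h'⟩
    omega

lemma exists_of_NS_pos {a b s : ℕ} (h : 0 < NS F n a b s) :
    ∃ t j k, a = t + j ∧ b = t + k ∧ s = j + k ∧ a ≤ n := by
  have hA : ∃ A : Subspaces F n, finrank F A = a := by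
    by_contra hA
    rw [NS, dif_neg hA] at h
    exact h.false
  obtain ⟨A, rfl⟩ := hA
  rw [NS_eq_ncard, Set.ncard_pos] at h
  obtain ⟨Y, hY, hY'⟩ := h
  have h1 := subspaceDist_add A Y
  have h2 := finrank_inf_le A Y
  have h3 := Submodule.finrank_le A
  rw [finrank_fin_fun] at h3
  exact ⟨finrank F ↥(A ⊓ Y), finrank F A - finrank F ↥(A ⊓ Y),
    finrank F Y - finrank F ↥(A ⊓ Y), by omega, by omega, by omega, h3⟩

/-- The bound on the distance distribution, compared with the sizes of spheres. -/
lemma gaussBinom_mul_alpha_le {r d w : ℕ} (hrn : 2 * r ≤ n) (hd : 1 ≤ d) (hdw : d ≤ w)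
    (hwr : w ≤ r) :
    gaussBinom (Fintype.card F) r w * alpha (Fintype.card F) (n - r) (w - d + 1) ≤
      ((Fintype.card F : ℝ) ^ ((n - r) * (d - 1)))⁻¹ * NS F n r r (2 * w) := by
  have hq : 1 < Fintype.card F := Fintype.one_lt_card
  have h1 := NS_eq (F := F) (n := n) (t := r - w) (j := w) (by omega) w
  have h2 := gaussBinom_symm hq (r - w) w
  rw [Nat.sub_add_cancel hwr] at h1 h2
  rw [two_mul, h1, h2]
  -- The required `w ≤ n - r` follows from `w ≤ r` and `2r ≤ n`.
  have h3 := alpha_mul_le hq (m := n - r) (a := w - d + 1) (c := d - 1) (by omega)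
  rw [show w - d + 1 + (d - 1) = w by omega] at h3
  have hw := alpha_pos hq (le_refl w)
  have hg := gaussBinom_nonneg (m := r) (u := w) hq
  have hp : (0 : ℝ) < (Fintype.card F : ℝ) ^ ((n - r) * (d - 1)) := pow_pos (by positivity) _
  have h4 : alpha (Fintype.card F) (n - r) (w - d + 1) ≤
      ((Fintype.card F : ℝ) ^ ((n - r) * (d - 1)))⁻¹ *
        ((Fintype.card F : ℝ) ^ (w * w) * gaussBinom (Fintype.card F) (n - r) w) := by
    rw [gaussBinom, ← div_eq_inv_mul, le_div_iff₀ hp, ← mul_div_assoc, le_div_iff₀ hw]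
    exact h3
  calc _ ≤ _ := mul_le_mul_of_nonneg_left h4 hg
    _ = _ := by ring

lemma weighted_JS_sum_le {r d u v : ℕ} (hrn : 2 * r ≤ n) (hd : 1 ≤ d)
    (hNS : 0 < NS F n r v u) :
    1 / (NS F n r v u : ℝ) * ∑ w ∈ Finset.Icc d r, gaussBinom (Fintype.card F) r w *
        alpha (Fintype.card F) (n - r) (w - d + 1) *
        ∑ s ∈ Finset.range d, (JS F n u s (2 * w) r r v : ℝ) ≤
      ∑ s ∈ Finset.range d,
        ((Fintype.card F : ℝ) ^ ((n - r) * (d - 1)))⁻¹ * (NS F n v r s : ℝ) := by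
  have hN : (0 : ℝ) < NS F n r v u := by exact_mod_cast hNS
  have hp : (0 : ℝ) < ((Fintype.card F : ℝ) ^ ((n - r) * (d - 1)))⁻¹ :=
    inv_pos.2 (pow_pos (by positivity) _)
  rw [one_div, ← div_eq_inv_mul, div_le_iff₀ hN]
  calc _ ≤ ∑ w ∈ Finset.Icc d r, ((Fintype.card F : ℝ) ^ ((n - r) * (d - 1)))⁻¹ *
        NS F n r r (2 * w) * ∑ s ∈ Finset.range d, (JS F n u s (2 * w) r r v : ℝ) := by
        refine Finset.sum_le_sum fun w hw => ?_
        rw [Finset.mem_Icc] at hw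
        exact mul_le_mul_of_nonneg_right (gaussBinom_mul_alpha_le hrn hd hw.1 hw.2)
          (Finset.sum_nonneg fun s _ => Nat.cast_nonneg _)
    _ = ∑ s ∈ Finset.range d, ((Fintype.card F : ℝ) ^ ((n - r) * (d - 1)))⁻¹ *
        ∑ w ∈ Finset.Icc d r, (NS F n r r (2 * w) : ℝ) * (JS F n u s (2 * w) r r v : ℝ) := by
        simp only [Finset.mul_sum]
        rw [Finset.sum_comm]
        refine Finset.sum_congr rfl fun s _ => Finset.sum_congr rfl fun w _ => ?_
        ring
    _ ≤ ∑ s ∈ Finset.range d, ((Fintype.card F : ℝ) ^ ((n - r) * (d - 1)))⁻¹ *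
        ((NS F n r v u : ℝ) * NS F n v r s) := by
        refine Finset.sum_le_sum fun s _ => mul_le_mul_of_nonneg_left ?_ hp.le
        exact_mod_cast sum_NS_mul_JS_le (by omega) u s d
    _ = _ := by
        rw [Finset.sum_mul]
        refine Finset.sum_congr rfl fun s _ => ?_
        ring

lemma NS_le {t e f : ℕ} (h : t + e ≤ n) :
    (NS F n (t + e) (t + f) (e + f) : ℝ) ≤ (K (Fintype.card F) ^ 2)⁻¹ *
      (Fintype.card F : ℝ) ^ ((e : ℝ) * f + t * e + f * (n - (t + e) - f)) := by
  have hq : 1 < Fintype.card F := Fintype.one_lt_card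
  have hq0 : (0 : ℝ) < Fintype.card F := by exact_mod_cast (zero_lt_one.trans hq)
  have hK := K_pos hq
  rw [NS_eq h]
  rcases le_or_gt f (n - (t + e)) with hf | hf
  · obtain ⟨g, hg⟩ := Nat.exists_eq_add_of_le hf
    have h1 := gaussBinom_le hq t e
    have h2 := gaussBinom_le hq f g
    have h3 : ((n : ℝ) - (t + e) - f) = g := by
      have : n = t + e + f + g := by omega
      rw [this]
      push_cast
      ring
    rw [hg, h3]
    have h4 : (Fintype.card F : ℝ) ^ ((e : ℝ) * f + t * e + f * g) =
        (Fintype.card F : ℝ) ^ (e * f) * (Fintype.card F : ℝ) ^ (t * e) *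
          (Fintype.card F : ℝ) ^ (f * g) := by
      rw [← pow_add, ← pow_add, ← Real.rpow_natCast]
      push_cast
      rfl
    rw [h4]
    have h5 := mul_le_mul h1 h2 (gaussBinom_nonneg hq) (by positivity)
    calc _ = (Fintype.card F : ℝ) ^ (e * f) * (gaussBinom (Fintype.card F) (t + e) t *
          gaussBinom (Fintype.card F) (f + g) f) := by ring
      _ ≤ _ := mul_le_mul_of_nonneg_left h5 (by positivity)
      _ = _ := by
        field_simp
  -- No such subspace exists here, so the left side is `0` whatever the real exponent is.
  · have h1 : gaussBinom (Fintype.card F) (n - (t + e)) f = 0 := by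
      rw [gaussBinom, alpha_eq_zero hf, zero_div]
    rw [h1, mul_zero]
    positivity

/-- Summation of the bound over the distances of one parity. -/
lemma sum_lt_of_parity {q d b : ℕ} (hq : 1 < q) (T : ℝ) (g : ℕ → ℝ)
    (hg : ∀ k < d, g k ≠ 0 → k % 2 = b ∧
      g k ≤ (K q ^ 2)⁻¹ * (q : ℝ) ^ (T - 3 / 4 * ((k / 2 : ℕ) : ℝ) ^ 2)) :
    ∑ k ∈ Finset.range d, g k < L q * (q : ℝ) ^ T := by
  classical
  have hq0 : (0 : ℝ) < q := by exact_mod_cast (zero_lt_one.trans hq)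
  let S : Finset ℕ := (Finset.range d).filter fun k => g k ≠ 0
  have hS : ∀ k ∈ S, k % 2 = b ∧
      g k ≤ (K q ^ 2)⁻¹ * (q : ℝ) ^ (T - 3 / 4 * ((k / 2 : ℕ) : ℝ) ^ 2) := by
    intro k hk
    rw [Finset.mem_filter, Finset.mem_range] at hk
    exact hg k hk.1 hk.2
  -- With the parity fixed, `k` is determined by `k / 2`, so each term of the series is used at most
  -- once.
  have hinj : Set.InjOn (fun k : ℕ => k / 2) S := by
    intro k hk l hl hkl
    have h1 := (hS k hk).1
    have h2 := (hS l hl).1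
    simp only at hkl
    omega
  calc ∑ k ∈ Finset.range d, g k = ∑ k ∈ S, g k := (Finset.sum_filter_ne_zero _).symm
    _ ≤ ∑ k ∈ S, (K q ^ 2)⁻¹ * (q : ℝ) ^ (T - 3 / 4 * ((k / 2 : ℕ) : ℝ) ^ 2) :=
        Finset.sum_le_sum fun k hk => (hS k hk).2
    _ = ∑ i ∈ S.image (fun k : ℕ => k / 2), (K q ^ 2)⁻¹ * (q : ℝ) ^ (T - 3 / 4 * (i : ℝ) ^ 2) :=
        (Finset.sum_image (f := fun i : ℕ =>
          (K q ^ 2)⁻¹ * (q : ℝ) ^ (T - 3 / 4 * (i : ℝ) ^ 2)) hinj).symm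
    _ = ((K q ^ 2)⁻¹ * ∑ i ∈ S.image (fun k : ℕ => k / 2), (q : ℝ) ^ (-(3 / 4 * (i : ℝ) ^ 2))) *
          (q : ℝ) ^ T := by
        rw [Finset.mul_sum, Finset.sum_mul]
        refine Finset.sum_congr rfl fun i _ => ?_
        rw [sub_eq_add_neg, add_comm, Real.rpow_add hq0, mul_assoc]
    _ < _ := mul_lt_mul_of_pos_right (sum_lt_L hq _) (Real.rpow_pos_of_pos hq0 T)

/-- `hT` isolates the comparison of exponents, with `t` the dimension of the intersection and `k = d
- 1 - s`; the parity `b` is the only other input. -/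
lemma sum_NS_lt {r d v b : ℕ} (hr : r ≤ n) (hd : 1 ≤ d) (T : ℝ)
    (hT : ∀ t e f k : ℕ, v = t + e → r = t + f → d = e + f + k + 1 → k % 2 = b ∧
      (e : ℝ) * f + t * e + f * (n - (t + e) - f) - (n - r) * (d - 1) ≤
        T - 3 / 4 * ((k / 2 : ℕ) : ℝ) ^ 2) :
    ∑ s ∈ Finset.range d,
        ((Fintype.card F : ℝ) ^ ((n - r) * (d - 1)))⁻¹ * (NS F n v r s : ℝ) <
      L (Fintype.card F) * (Fintype.card F : ℝ) ^ T := by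
  have hq : 1 < Fintype.card F := Fintype.one_lt_card
  have hq1 : (1 : ℝ) ≤ Fintype.card F := by exact_mod_cast hq.le
  have hq0 : (0 : ℝ) < Fintype.card F := by linarith
  rw [← Finset.sum_range_reflect]
  refine sum_lt_of_parity (b := b) hq T _ fun k hk hne => ?_
  have hpos : 0 < NS F n v r (d - 1 - k) := by
    refine Nat.pos_of_ne_zero fun h => hne ?_
    rw [h, Nat.cast_zero, mul_zero]
  obtain ⟨t, e, f, rfl, rfl, hs, hvn⟩ := exists_of_NS_pos hpos
  obtain ⟨hk2, hE⟩ := hT t e f k rfl rfl (by omega)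
  refine ⟨hk2, ?_⟩
  have h1 := NS_le (F := F) (f := f) hvn
  rw [hs]
  have h2 : ((Fintype.card F : ℝ) ^ ((n - (t + f)) * (d - 1)))⁻¹ =
      (Fintype.card F : ℝ) ^ (-(((n : ℝ) - ((t + f : ℕ) : ℝ)) * ((d : ℝ) - 1))) := by
    rw [Real.rpow_neg hq0.le, ← Real.rpow_natCast, Nat.cast_mul, Nat.cast_sub hr, Nat.cast_sub hd,
      Nat.cast_one]
  rw [h2]
  calc _ ≤ _ := mul_le_mul_of_nonneg_left h1 (Real.rpow_nonneg hq0.le _)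
    _ = (K (Fintype.card F) ^ 2)⁻¹ * (Fintype.card F : ℝ) ^
          ((e : ℝ) * f + t * e + f * (n - (t + e) - f) -
            ((n : ℝ) - ((t + f : ℕ) : ℝ)) * ((d : ℝ) - 1)) := by
        rw [Real.rpow_sub hq0, Real.rpow_neg hq0.le, div_eq_mul_inv]
        ring
    _ ≤ _ := mul_le_mul_of_nonneg_left (Real.rpow_le_rpow_of_exponent_le hq1 hE)
        (inv_nonneg.2 (sq_nonneg _))

end Bound

end SubspaceCoding

/-! ### The exact value and the bounds -/

theorem proposition5 {F : Type*} [Field F] [Fintype F] (n r d u v : ℕ) (hd : 1 ≤ d)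
    (𝒞 : Set (SubspaceCoding.Subspaces F n)) (h𝒞 : SubspaceCoding.IsCDC 𝒞 r (2 * d))
    (C : SubspaceCoding.Subspaces F n) (hC : C ∈ 𝒞)
    (W : SubspaceCoding.OperatorChannel F n) (hW : W.IsSymmetric)
    (dec : SubspaceCoding.Subspaces F n → Option (SubspaceCoding.Subspaces F n))
    (hdec : SubspaceCoding.IsBDD 𝒞 (d - 1) dec) :
    -- the exact value; the event on which one conditions has positive probability
    (0 < SubspaceCoding.NS F n r v u → d + 1 ≤ u → |(v : ℤ) - (r : ℤ)| ≤ (d : ℤ) - 1 →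
      0 < (W C).toOuterMeasure (SubspaceCoding.sphere C v u) →
      SubspaceCoding.DEP W dec C u v =
        1 / (SubspaceCoding.NS F n r v u : ℝ) *
          ∑ w ∈ Finset.Icc d r, (SubspaceCoding.distDistr 𝒞 C w : ℝ) *
            ∑ s ∈ Finset.range d, (SubspaceCoding.JS F n u s (2 * w) r r v : ℝ)) ∧
    -- the cases where there is no decoder error
    (¬ (0 < SubspaceCoding.NS F n r v u ∧ d + 1 ≤ u ∧ |(v : ℤ) - (r : ℤ)| ≤ (d : ℤ) - 1) →
      SubspaceCoding.DEP W dec C u v = 0) ∧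
    -- the bounds for liftings of rank metric codes
    (∀ R : Set (Matrix (Fin r) (Fin (n - r)) F), 2 * r ≤ n → 𝒞 = SubspaceCoding.lift '' R →
      0 < SubspaceCoding.NS F n r v u →
      SubspaceCoding.DEP W dec C u v ≤
        1 / (SubspaceCoding.NS F n r v u : ℝ) *
          ∑ w ∈ Finset.Icc d r,
            SubspaceCoding.gaussBinom (Fintype.card F) r w *
              SubspaceCoding.alpha (Fintype.card F) (n - r) (w - d + 1) *
            ∑ s ∈ Finset.range d, (SubspaceCoding.JS F n u s (2 * w) r r v : ℝ) ∧
      (Even ((d : ℤ) - 1 + r - v) →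
        1 / (SubspaceCoding.NS F n r v u : ℝ) *
          ∑ w ∈ Finset.Icc d r,
            SubspaceCoding.gaussBinom (Fintype.card F) r w *
              SubspaceCoding.alpha (Fintype.card F) (n - r) (w - d + 1) *
            ∑ s ∈ Finset.range d, (SubspaceCoding.JS F n u s (2 * w) r r v : ℝ) <
        SubspaceCoding.L (Fintype.card F) * (Fintype.card F : ℝ) ^
          (-(((d : ℝ) - 1 + v - r) / 2 * ((n : ℝ) - 2 * r + ((d : ℝ) - 1 - v + r) / 2)))) ∧
      (Odd ((d : ℤ) - 1 + r - v) →
        1 / (SubspaceCoding.NS F n r v u : ℝ) *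
          ∑ w ∈ Finset.Icc d r,
            SubspaceCoding.gaussBinom (Fintype.card F) r w *
              SubspaceCoding.alpha (Fintype.card F) (n - r) (w - d + 1) *
            ∑ s ∈ Finset.range d, (SubspaceCoding.JS F n u s (2 * w) r r v : ℝ) <
        SubspaceCoding.L (Fintype.card F) * (Fintype.card F : ℝ) ^
          (-(((d : ℝ) - 1 + v - r) / 2 * ((n : ℝ) - 2 * r + ((d : ℝ) - 1 + r - v) / 2)) -
            1 / 2 * ((n : ℝ) - d + 1 + 1 / 2)))) := by

  have hq : 1 < Fintype.card F := Fintype.one_lt_card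
  have hq0 : (0 : ℝ) < Fintype.card F := by exact_mod_cast (zero_lt_one.trans hq)
  refine ⟨fun _ _ _ hpos => SubspaceCoding.DEP_eq_sum hd h𝒞 hdec hC u v hW hpos,
    SubspaceCoding.DEP_eq_zero hd h𝒞 hdec hC u v W, ?_⟩
  intro R hrn hR hNS
  refine ⟨?_, fun heven => ?_, fun hodd => ?_⟩
  · have hJ : ∀ w, (0 : ℝ) ≤ ∑ s ∈ Finset.range d, (SubspaceCoding.JS F n u s (2 * w) r r v : ℝ) :=
      fun w => Finset.sum_nonneg fun s _ => Nat.cast_nonneg _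
    -- If the conditioning event is null, the DEP is `0` by convention and the bound is only
    -- nonnegativity.
    rcases eq_or_ne ((W C).toOuterMeasure (SubspaceCoding.sphere C v u)) 0 with h0 | h0
    · rw [SubspaceCoding.DEP_eq_zero_of_measure_eq_zero dec C u v h0]
      exact mul_nonneg (one_div_nonneg.2 (Nat.cast_nonneg _)) (Finset.sum_nonneg fun w _ =>
        mul_nonneg (mul_nonneg (SubspaceCoding.gaussBinom_nonneg hq)
          (SubspaceCoding.alpha_nonneg hq)) (hJ w))
    · rw [SubspaceCoding.DEP_eq_sum hd h𝒞 hdec hC u v hW (pos_iff_ne_zero.2 h0)]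
      refine mul_le_mul_of_nonneg_left (Finset.sum_le_sum fun w hw => ?_)
        (one_div_nonneg.2 (Nat.cast_nonneg _))
      subst hR
      exact mul_le_mul_of_nonneg_right (SubspaceCoding.distDistr_lift_le (by omega) hd
        (Finset.mem_Icc.1 hw).1 h𝒞 hC) (hJ w)
  -- For `r < d` the sum over `w` is empty. Otherwise `d ≤ r` and `2r ≤ n` yield `d - 1 ≤ n`, needed
  -- for `hn`.
  · rcases lt_or_ge r d with hrd | hrd
    · rw [Finset.Icc_eq_empty (by omega), Finset.sum_empty, mul_zero]
      exact mul_pos (SubspaceCoding.L_pos hq) (Real.rpow_pos_of_pos hq0 _)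
    refine (SubspaceCoding.weighted_JS_sum_le hrn hd hNS).trans_lt
      (SubspaceCoding.sum_NS_lt (b := 0) (by omega) hd _ ?_)
    rintro t e f k rfl rfl rfl
    have hk : k % 2 = 0 := by
      rw [Int.even_iff] at heven
      push_cast at heven
      omega
    refine ⟨hk, ?_⟩
    obtain ⟨i, rfl⟩ : ∃ i, k = 2 * i := ⟨k / 2, by omega⟩
    have hn : ((e : ℝ) + f + 2 * i) ≤ n := by
      have : e + f + 2 * i ≤ n := by omega
      exact_mod_cast this
    rw [Nat.mul_div_cancel_left i two_pos]
    push_cast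
    -- The target exponent minus the actual one equals `i (n - e - f - i)`, at least `i²` by `hn`.
    nlinarith [mul_nonneg (Nat.cast_nonneg (α := ℝ) i) (sub_nonneg.2 hn), sq_nonneg (i : ℝ)]
  · rcases lt_or_ge r d with hrd | hrd
    · rw [Finset.Icc_eq_empty (by omega), Finset.sum_empty, mul_zero]
      exact mul_pos (SubspaceCoding.L_pos hq) (Real.rpow_pos_of_pos hq0 _)
    refine (SubspaceCoding.weighted_JS_sum_le hrn hd hNS).trans_lt
      (SubspaceCoding.sum_NS_lt (b := 1) (by omega) hd _ ?_)
    rintro t e f k rfl rfl rfl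
    have hk : k % 2 = 1 := by
      rw [Int.odd_iff] at hodd
      push_cast at hodd
      omega
    refine ⟨hk, ?_⟩
    obtain ⟨i, rfl⟩ : ∃ i, k = 2 * i + 1 := ⟨k / 2, by omega⟩
    have hn : ((e : ℝ) + f + (2 * i + 1)) ≤ n := by
      have : e + f + (2 * i + 1) ≤ n := by omega
      exact_mod_cast this
    rw [show (2 * i + 1) / 2 = i by omega]
    push_cast
    -- Again the difference is `i (n - e - f - i)`, now at least `i (i + 1)`; the extra half term of
    -- the odd exponent makes it vanish at `k = 1`.
    nlinarith [mul_nonneg (Nat.cast_nonneg (α := ℝ) i) (sub_nonneg.2 hn), sq_nonneg (i : ℝ),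
      Nat.cast_nonneg (α := ℝ) i]
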